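/- **Setting.** Fix $k\in\mathbb N_0$, $\beta>0$ and $0<\eta<1/4$. Let $D=[0,1]^k$ with periodic boundary conditions (the flat unit torus), $S=\mathbb R\times D$ with points $z=(x,y)$, and let $\Lambda_N=[0,N]\times D$. A *bridge* is a continuous path $b:[0,\beta]\to S$ with $b(0)=b(\beta)$; the space of bridges carries the topology of uniform convergence and its Borel $\sigma$-algebra. A *configuration* is a set $\omega$ of bridges such that only finitely many $b\in\omega$ start in any given compact subset of $S$. Let $\mathsf{Conf}$ be the set of configurations, with the $\sigma$-algebra generated by the maps $\omega\mapsto\#(\omega\cap A)$, $A$ a measurable set of bridges. For $\Lambda\subset S$ put $\omega_\Lambda=\{b\in\omega: b(0)\in\Lambda\}$, and for measurable $\Lambda$ let $P_\Lambda$ be the image of $P$ under $\omega\mapsto\omega_\Lambda$. For $n\in\mathbb Z$ the shift $\theta_n$ acts on points by $(x,y)\mapsto(x-n,y)$ and correspondingly on configurations. Let $\mathcal P$ be the set of probability measures on $\mathsf{Conf}$ and $\mathcal P_{\mathrm s}$ the set of those invariant under all $\theta_n$, $n\in\mathbb Z$. The $\tau_{\mathcal L_b}$-topology is the smallest topology on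 $\mathcal P$ for which $P\mapsto\mathbb E_P[f]$ is continuous for every bounded measurable $f:\mathsf{Conf}\to\mathbb R$ that is local, i.e. $f(\omega)=f(\omega_\Lambda)$ for all $\omega$, for some bounded $\Lambda\subset S$. **Entropy.** Let $\mathsf{Poi}$ be the law of the homogeneous Poisson point process of unit intensity on $S$, marked with independent standard Brownian bridges: a point $z$ carries the bridge $z+B$, where $B$ is the image in $S$ of a standard Brownian bridge of $\mathbb R^{k+1}$ from $0$ to $0$ of time-length $\beta$ and diffusion parameter $1$. For $P\in\mathcal P_{\mathrm s}$ let $$\mathsf{ent}(P)=\lim_{N\to\infty}\frac1N\int\log\frac{dP_{\Lambda_N}}{d\mathsf{Poi}_{\Lambda_N}}\,dP_{\Lambda_N}\in[0,\infty],$$ the integral being $\infty$ if $P_{\Lambda_N}\not\ll\mathsf{Poi}_{\Lambda_N}$; let $\mathsf{ent}(P)=\infty$ for $P\in\mathcal P\setminus\mathcal P_{\mathrm s}$. **Energy.** Let $g$ be the Green's function of $S$ ($-\Delta g=\delta_o$, free boundary conditions in $x$ and periodic ones in $y$), $$g(x,y)=-\frac{|x|}2+\sum_{n\in\mathbb Z^k\setminus\{0\}}\frac{e^{-2\pi|n||x|}}{4\pi|n|}\cos(2\pi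 n\cdot y),$$ and let $\delta_z^\eta$ be the uniform probability measure on the sphere of radius $\eta$ around $z\in S$. For bounded $\Lambda\subset S$ put $$V_t(z,\omega,\Lambda)=\int_S g(z-z')\Big(\sum_{b\in\omega_\Lambda}\delta^\eta_{b(t)}-\mathbf 1_\Lambda\Big)(dz').$$ Let $\mathsf{Neut}(\Lambda)$ be the set of configurations of exactly $|\Lambda|$ bridges all of which start in $\Lambda$. For $I=[l,r]$ and $K=I\times D$ put $I^-=[\,l+\lceil (r-l)^{7/8}\rceil,\ r-\lceil (r-l)^{7/8}\rceil\,]$ and $K^-=I^-\times D$, and let $\Theta(K)$ be the set of configurations in which no bridge that starts outside $K$ ever visits $K^-$. Put $$\widetilde H_{K}(\omega)=\inf\Big\{\frac1{2\beta}\int_{K\times[0,\beta]}|\nabla V_t(z,\omega',\Lambda)|^2\,d(z,t)\Big\},$$ the infimum over all $\Lambda=[p,q]\times D\supset K$ with $p,q\in\mathbb Z$ and all $\omega'\in\mathsf{Neut}(\Lambda)\cap\Theta(K)$ with $\omega'_K=\omega_K$. For $P\in\mathcal P_{\mathrm s}$ with $\mathsf{ent}(P)<\infty$ and $0\le M<\infty$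 let $$\mathbb W_\beta^M(P)=\lim_{N\to\infty}\mathbb E_P\big[(N^{-1}\widetilde H_{\Lambda_N}(\omega))\wedge M\big],\qquad \mathbb W_\beta(P)=\lim_{M\to\infty}\mathbb W_\beta^M(P).$$ **Free energy.** Let $\mathcal F_\beta(P)=\mathbb W_\beta(P)+\beta^{-1}\mathsf{ent}(P)$ if $P\in\mathcal P_{\mathrm s}$ and $\mathsf{ent}(P)<\infty$, and $\mathcal F_\beta(P)=\infty$ for all other $P\in\mathcal P$. **Proposition.** The limits defining $\mathsf{ent}(P)$ (for $P\in\mathcal P_{\mathrm s}$), and $\mathbb W^M_\beta(P)$ and $\mathbb W_\beta(P)$ (for $P\in\mathcal P_{\mathrm s}$ with $\mathsf{ent}(P)<\infty$), exist in $[0,\infty]$, so that $\mathcal F_\beta:\mathcal P\to[0,\infty]$ is well defined, and $\mathcal F_\beta$ is lower semicontinuous in the $\tau_{\mathcal L_b}$-topology. -/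

import Mathlib

open MeasureTheory ProbabilityTheory Filter Topology Set
open scoped ENNReal NNReal

noncomputable section

namespace QuantumJellium

/-! ### The cylinder, loops and configurations -/

/-- The cylinder `S = ℝ × D`, where the cross-section `D = [0,1]^k` carries periodic boundary
conditions, i.e. is the flat unit torus. A point is written `z = (x, y)`. -/
abbrev Cyl (k : ℕ) : Type := ℝ × (Fin k → UnitAddCircle)

/-- The domain `I × D` over a set `I ⊆ ℝ` of `x`-coordinates. -/
def slab (k : ℕ) (I : Set ℝ) : Set (Cyl k) := {z | z.1 ∈ I}

/-- Bridges: continuous paths `[0, β] → S` with the times `0` and `β` identified, equipped with the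
topology of uniform convergence and its Borel `σ`-algebra. -/
abbrev Loop (k : ℕ) (β : ℝ) : Type := C(AddCircle β, Cyl k)

instance instMeasurableSpaceLoop (k : ℕ) (β : ℝ) : MeasurableSpace (Loop k β) := borel _

instance instBorelSpaceLoop (k : ℕ) (β : ℝ) : BorelSpace (Loop k β) := ⟨rfl⟩

/-- The bridge `b` translated by the vector `w`. -/
def translate {k : ℕ} {β : ℝ} (w : Cyl k) (b : Loop k β) : Loop k β :=
  b + ContinuousMap.const _ w

/-- Bridge configurations: sets of bridges such that only finitely many of them start in any given
compact subset of `S`. -/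
@[ext] structure Conf (k : ℕ) (β : ℝ) where
  bridges : Set (Loop k β)
  locallyFinite : ∀ K : Set (Cyl k), IsCompact K → {b | b ∈ bridges ∧ b 0 ∈ K}.Finite

variable {k : ℕ} {β : ℝ}

/-- The number of bridges of `ω` that belong to `A`. -/
def count (A : Set (Loop k β)) (ω : Conf k β) : ℕ∞ := {b | b ∈ ω.bridges ∧ b ∈ A}.encard

/-- The `σ`-algebra generated by the counting maps of measurable sets of bridges. -/
instance instMeasurableSpaceConf : MeasurableSpace (Conf k β) :=
  ⨆ (A : Set (Loop k β)) (_ : MeasurableSet A), MeasurableSpace.comap (count A) ⊤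

/-- The projection `ω ↦ ω_Λ`: keep the bridges that start in `Λ`. -/
def proj (Λ : Set (Cyl k)) (ω : Conf k β) : Conf k β where
  bridges := {b | b ∈ ω.bridges ∧ b 0 ∈ Λ}
  locallyFinite K hK := (ω.locallyFinite K hK).subset fun _ hb => ⟨hb.1.1, hb.2⟩

/-- The vector `(n, 0)` of `S`. -/
def xVec (k : ℕ) (n : ℤ) : Cyl k := ((n : ℝ), 0)

/-- The discrete shift `θ_n`, which acts on points by `(x, y) ↦ (x - n, y)`. -/
def shift (n : ℤ) (ω : Conf k β) : Conf k β where
  bridges := translate (-xVec k n) '' ω.bridges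
  locallyFinite K hK := by
    have hK' : IsCompact ((fun z => z + xVec k n) '' K) := hK.image (by fun_prop)
    refine ((ω.locallyFinite _ hK').image (translate (-xVec k n))).subset ?_
    rintro _ ⟨⟨b, hb, rfl⟩, h0⟩
    refine ⟨b, ⟨hb, _, h0, ?_⟩, rfl⟩
    simp [translate]

/-! The maps above are measurable, so that image measures under them are genuine. -/

theorem measurable_count {A : Set (Loop k β)} (hA : MeasurableSet A) :
    Measurable (count A : Conf k β → ℕ∞) := by
  rw [measurable_iff_comap_le]
  exact le_iSup₂_of_le (f := fun (A : Set (Loop k β)) (_ : MeasurableSet A) =>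
    MeasurableSpace.comap (count A) ⊤) A hA le_rfl

theorem measurable_of_count {Ω : Type*} [MeasurableSpace Ω] {f : Ω → Conf k β}
    (h : ∀ A, MeasurableSet A → Measurable fun x => count A (f x)) : Measurable f := by
  rw [measurable_iff_comap_le]
  unfold instMeasurableSpaceConf
  simp only [MeasurableSpace.comap_iSup, MeasurableSpace.comap_comp]
  exact iSup₂_le fun A hA => measurable_iff_comap_le.1 (h A hA)

theorem measurable_proj {Λ : Set (Cyl k)} (hΛ : MeasurableSet Λ) :
    Measurable (proj Λ : Conf k β → Conf k β) := by
  refine measurable_of_count fun A hA => ?_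
  have h0 : Measurable fun b : Loop k β => b 0 :=
    (continuous_eval_const (0 : AddCircle β)).measurable
  convert measurable_count (hA.inter (h0 hΛ)) using 2 with ω
  simp only [count, proj]
  congr 1
  ext b
  simp only [mem_ofPred_eq, mem_inter_iff, mem_preimage]
  tauto

theorem measurable_shift (n : ℤ) : Measurable (shift n : Conf k β → Conf k β) := by
  refine measurable_of_count fun A hA => ?_
  have h0 : Measurable (translate (-xVec k n) : Loop k β → Loop k β) :=
    (continuous_id.add continuous_const).measurable
  convert measurable_count (h0 hA) using 2 with ω
  have hinj : Function.Injective (translate (-xVec k n) : Loop k β → Loop k β) :=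
    fun a b h => add_right_cancel h
  rw [count, count, ← hinj.encard_image {b | b ∈ ω.bridges ∧ b ∈ translate (-xVec k n) ⁻¹' A}]
  congr 1
  ext b
  simp only [shift, mem_ofPred_eq, mem_image, mem_preimage]
  constructor
  · rintro ⟨⟨a, ha, hab⟩, hb⟩
    exact ⟨a, ⟨ha, by rwa [hab]⟩, hab⟩
  · rintro ⟨a, ⟨ha, hb⟩, hab⟩
    exact ⟨⟨a, ha, hab⟩, by rwa [← hab]⟩

/-! ### The `τ`-topology on laws of bridge configurations -/

/-- `f` is a bounded local observable: measurable, bounded, and `f ω = f ω_Λ` for some bounded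
`Λ ⊆ S`. -/
def IsBoundedLocal (f : Conf k β → ℝ) : Prop :=
  Measurable f ∧ (∃ C : ℝ, ∀ ω, |f ω| ≤ C) ∧
    ∃ Λ : Set (Cyl k), Bornology.IsBounded Λ ∧ ∀ ω, f ω = f (proj Λ ω)

/-- The smallest topology on the set of probability measures on configurations such that
`P ↦ E_P[f]` is continuous for every bounded local observable `f`. -/
instance instTauTopology : TopologicalSpace (ProbabilityMeasure (Conf k β)) :=
  ⨅ (f : Conf k β → ℝ) (_ : IsBoundedLocal f),
    TopologicalSpace.induced (fun P : ProbabilityMeasure (Conf k β) => ∫ ω, f ω ∂(P : Measure _))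
      inferInstance

/-- Stationarity: invariance under the shifts `θ_n`, `n ∈ ℤ`. -/
def IsStationary (P : ProbabilityMeasure (Conf k β)) : Prop :=
  ∀ n : ℤ, (P : Measure (Conf k β)).map (shift n) = (P : Measure (Conf k β))

/-- The box `Λ_N = [0, N] × D`. -/
def box (k N : ℕ) : Set (Cyl k) := slab k (Icc 0 (N : ℝ))

/-! ### Brownian bridges and the reference Poisson process -/

/-- The Schauder function of level `j` and position `m` on the circle of length `β`: the tent of
height `√β 2^{-j/2-1}` over the dyadic interval `[m, m+1] · 2^{-j} β`, `0 ≤ m < 2 ^ j`. (The norm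
of `AddCircle β` is the distance on the circle.) -/
def tent (β : ℝ) (j m : ℕ) : C(AddCircle β, ℝ) where
  toFun t := √β * (√(2 ^ j) / 2 ^ (j + 1)) *
    max 0 (1 - 2 ^ (j + 1) / β * ‖t - (((2 * m + 1) / 2 ^ (j + 1) * β : ℝ) : AddCircle β)‖)
  continuous_toFun := by fun_prop

/-- Lévy's construction of the standard Brownian bridge from `0` to `0` of time-length `β` and
diffusion parameter `1`: for i.i.d. standard Gaussian coefficients `ξ j m` this is the almost surely
uniformly convergent series of the functions `ξ j m • tent β j m`. -/
def brownianBridge (β : ℝ) (ξ : ℕ × ℕ → ℝ) : C(AddCircle β, ℝ) :=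
  limUnder atTop fun J : ℕ =>
    ∑ j ∈ Finset.range J, ∑ m ∈ Finset.range (2 ^ j), ξ (j, m) • tent β j m

/-- The canonical projection `ℝ × ℝ^k → S`. -/
def wrap {k : ℕ} (v : Fin (k + 1) → ℝ) : Cyl k := (v 0, fun i => ((v i.succ : ℝ) : UnitAddCircle))

/-- The bridge in `S` with starting point `z`, whose `k + 1` coordinates are driven by the
one-dimensional standard Brownian bridges with coefficients `ξ i`. -/
def bridgeFrom (β : ℝ) {k : ℕ} (z : Cyl k) (ξ : Fin (k + 1) → ℕ × ℕ → ℝ) : Loop k β where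
  toFun t := z + wrap fun i => brownianBridge β (ξ i) t
  continuous_toFun := by
    unfold wrap
    refine continuous_const.add (Continuous.prodMk (by fun_prop) (continuous_pi fun i => ?_))
    exact (AddCircle.continuous_mk' 1).comp (by fun_prop)

/-- The randomness used in one cell: a number of points, and for each index a starting point in the
cell `[0, 1) × D` and Gaussian coefficients for the bridge. -/
abbrev CellSample (k : ℕ) : Type := ℕ × (ℕ → Cyl k × (Fin (k + 1) → ℕ × ℕ → ℝ))

/-- The law of a `CellSample`: a Poisson number of mean `1`, independent uniform starting points in
`[0, 1) × D`, independent standard Gaussian coefficients. -/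
def cellLaw (k : ℕ) : Measure (CellSample k) :=
  (poissonMeasure 1).prod <| Measure.infinitePi fun _ : ℕ =>
    (volume.restrict (slab k (Ico 0 1))).prod <|
      Measure.infinitePi fun _ => Measure.infinitePi fun _ => gaussianReal 0 1

/-- The configuration built from a sample for every cell `[i, i + 1) × D`, `i ∈ ℤ`: in the `i`-th
cell start the bridges with index `j` smaller than the number of points of that cell. -/
def assemble (β : ℝ) {k : ℕ} (s : ℤ → CellSample k) : Conf k β where
  bridges := {b | ∃ i : ℤ, ∃ j < (s i).1,
    b = bridgeFrom β (((s i).2 j).1 + xVec k i) ((s i).2 j).2 ∧ b 0 ∈ slab k (Ico i (i + 1))}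
  locallyFinite K hK := by
    obtain ⟨R, hR⟩ := (hK.image continuous_fst).isBounded.subset_closedBall (0 : ℝ)
    have hfin : (⋃ i ∈ Set.Icc (⌊-R⌋) ⌈R⌉, (fun j => bridgeFrom β (((s i).2 j).1 + xVec k i)
        ((s i).2 j).2) '' (Set.Iio (s i).1)).Finite :=
      (Set.finite_Icc _ _).biUnion fun i _ => (Set.finite_Iio _).image _
    refine hfin.subset ?_
    rintro b ⟨⟨i, j, hj, hb, h0⟩, hbK⟩
    have h1 := hR ⟨_, hbK, rfl⟩
    simp only [Metric.mem_closedBall, dist_zero_right, Real.norm_eq_abs, abs_le] at h1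
    have h2 : ((i : ℝ) ≤ (b 0).1 ∧ (b 0).1 < i + 1) := h0
    have h3 : ⌊-R⌋ ≤ i := by
      have : ((⌊-R⌋ : ℤ) : ℝ) < (i : ℝ) + 1 := (Int.floor_le _).trans_lt (by linarith)
      exact Int.lt_add_one_iff.1 (by exact_mod_cast this)
    have h4 : i ≤ ⌈R⌉ := by
      have : (i : ℝ) ≤ (⌈R⌉ : ℤ) := (by linarith : (i : ℝ) ≤ R).trans (Int.le_ceil _)
      exact_mod_cast this
    exact Set.mem_biUnion (show i ∈ Set.Icc _ _ from ⟨h3, h4⟩) ⟨j, hj, hb.symm⟩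

/-- The law of the unit-intensity homogeneous Poisson point process on `S`, marked with independent
standard Brownian bridges: superposition of independent Poisson processes in the unit cells. -/
def poissonLaw (k : ℕ) (β : ℝ) : Measure (Conf k β) :=
  (Measure.infinitePi fun _ : ℤ => cellLaw k).map (assemble β)

/-! The Poisson law is a probability measure (the map `assemble` is measurable). -/

theorem measurable_brownianBridge [Fact (0 < β)] : @Measurable _ _ _ (borel _) (brownianBridge β) := by
  let : MeasurableSpace C(AddCircle β, ℝ) := borel _
  have : BorelSpace C(AddCircle β, ℝ) := ⟨rfl⟩
  refine (StronglyMeasurable.limUnder fun J => ?_).measurable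
  refine Finset.stronglyMeasurable_fun_sum _ fun j _ => Finset.stronglyMeasurable_fun_sum _ fun m _ => ?_
  exact (measurable_pi_apply _).stronglyMeasurable.smul_const _

theorem measurable_bridgeFrom [Fact (0 < β)] :
    Measurable fun p : Cyl k × (Fin (k + 1) → ℕ × ℕ → ℝ) => bridgeFrom β p.1 p.2 := by
  let : MeasurableSpace C(AddCircle β, ℝ) := borel _
  have : BorelSpace C(AddCircle β, ℝ) := ⟨rfl⟩
  have hc : Continuous fun q : Cyl k × (Fin (k + 1) → C(AddCircle β, ℝ)) =>
      (⟨fun t => q.1 + wrap fun i => q.2 i t, by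
        unfold wrap
        refine continuous_const.add (Continuous.prodMk (by fun_prop) (continuous_pi fun i => ?_))
        exact (AddCircle.continuous_mk' 1).comp (by fun_prop)⟩ : Loop k β) := by
    refine ContinuousMap.continuous_of_continuous_uncurry _ ?_
    unfold wrap
    have he : ∀ i : Fin (k + 1), Continuous
        fun x : (Cyl k × (Fin (k + 1) → C(AddCircle β, ℝ))) × AddCircle β => x.1.2 i x.2 :=
      fun i => by fun_prop
    refine (continuous_fst.comp continuous_fst).add
      (Continuous.prodMk (he 0) (continuous_pi fun i => ?_))
    exact (AddCircle.continuous_mk' 1).comp (he i.succ)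
  have hm := hc.measurable
  exact hm.comp (measurable_fst.prodMk (measurable_pi_lambda _ fun i =>
    measurable_brownianBridge.comp ((measurable_pi_apply i).comp measurable_snd)))

theorem measurable_encard_range {Ω X ι : Type*} [MeasurableSpace Ω] [MeasurableSpace X]
    [Countable ι] (f : ι → Ω → X) (D : ι → Set Ω) (hD : ∀ i, MeasurableSet (D i))
    (hE : ∀ i j, MeasurableSet {ω | f i ω = f j ω}) :
    Measurable fun ω => {x | ∃ i, ω ∈ D i ∧ x = f i ω}.encard := by
  classical
  rcases isEmpty_or_nonempty ι with hι | hι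
  · simp
  have key : ∀ n : ℕ, MeasurableSet {ω | (n : ℕ∞) ≤ {x | ∃ i, ω ∈ D i ∧ x = f i ω}.encard} := by
    intro n
    have : {ω | (n : ℕ∞) ≤ {x | ∃ i, ω ∈ D i ∧ x = f i ω}.encard} =
        ⋃ s : {s : Finset ι // s.card = n}, {ω | (∀ i ∈ s.1, ω ∈ D i) ∧
          ∀ i ∈ s.1, ∀ j ∈ s.1, f i ω = f j ω → i = j} := by
      ext ω
      simp only [mem_ofPred_eq, mem_iUnion]
      constructor
      · intro h
        obtain ⟨t, ht, htn⟩ := Set.exists_subset_encard_eq h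
        have htf : t.Finite := Set.finite_of_encard_eq_coe htn
        choose! g hg using ht
        have hinj : Set.InjOn g t := fun a ha b hb hab => by
          rw [(hg ha).2, (hg hb).2, hab]
        refine ⟨⟨htf.toFinset.image g, ?_⟩, ?_, ?_⟩
        · rw [Finset.card_image_of_injOn (by simpa using hinj)]
          rw [htf.encard_eq_coe_toFinset_card] at htn
          exact_mod_cast htn
        · simp only [Finset.mem_image, Finite.mem_toFinset]
          rintro _ ⟨a, ha, rfl⟩
          exact (hg ha).1
        · simp only [Finset.mem_image, Finite.mem_toFinset]
          rintro _ ⟨a, ha, rfl⟩ _ ⟨b, hb, rfl⟩ h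
          rw [← (hg ha).2, ← (hg hb).2] at h
          rw [h]
      · rintro ⟨⟨s, hs⟩, h1, h2⟩
        have h3 : Set.InjOn (fun i => f i ω) s := fun i hi j hj hij => h2 i hi j hj hij
        calc (n : ℕ∞) = ((fun i => f i ω) '' (s : Set ι)).encard := by
              rw [h3.encard_image, Set.encard_coe_eq_coe_finsetCard, hs]
          _ ≤ _ := Set.encard_le_encard (by
              rintro _ ⟨i, hi, rfl⟩
              exact ⟨i, h1 i hi, rfl⟩)
    rw [this]
    refine MeasurableSet.iUnion fun s => ?_
    have h4 : {ω | (∀ i ∈ s.1, ω ∈ D i) ∧ ∀ i ∈ s.1, ∀ j ∈ s.1, f i ω = f j ω → i = j} =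
        (⋂ i ∈ s.1, D i) ∩ ⋂ i ∈ s.1, ⋂ j ∈ s.1, {ω | f i ω = f j ω → i = j} := by
      ext ω
      simp
    rw [h4]
    refine (s.1.measurableSet_biInter fun i _ => hD i).inter (s.1.measurableSet_biInter fun i _ =>
      s.1.measurableSet_biInter fun j _ => ?_)
    by_cases hij : i = j
    · simp [hij]
    · simpa [hij, compl_ofPred] using (hE i j).compl
  refine measurable_to_countable' fun a => ?_
  induction a using ENat.recTopCoe with
  | top =>
    convert MeasurableSet.iInter key using 1
    ext ω
    simp [ENat.eq_top_iff_forall_ge]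
  | coe n =>
    convert (key n).diff (key (n + 1)) using 1
    ext ω
    simp only [mem_preimage, mem_singleton_iff, Set.mem_sdiff, mem_ofPred_eq, Nat.cast_add, Nat.cast_one,
      ENat.add_one_le_iff (ENat.natCast_ne_top n), not_lt]
    exact ⟨fun h => ⟨h.ge, h.le⟩, fun h => le_antisymm h.2 h.1⟩

theorem measurable_assemble [Fact (0 < β)] :
    Measurable (assemble β : (ℤ → CellSample k) → Conf k β) := by
  have : PolishSpace (Loop k β) := inferInstance
  refine measurable_of_count fun A hA => ?_
  let f : ℤ × ℕ → (ℤ → CellSample k) → Loop k β := fun p s =>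
    bridgeFrom β (((s p.1).2 p.2).1 + xVec k p.1) ((s p.1).2 p.2).2
  have hf : ∀ p, Measurable (f p) := fun p => by
    have h1 : Measurable fun s : ℤ → CellSample k => (s p.1).2 p.2 :=
      (measurable_pi_apply _).comp (measurable_snd.comp (measurable_pi_apply _))
    exact measurable_bridgeFrom.comp ((h1.fst.add_const _).prodMk h1.snd)
  have hE : ∀ p q, MeasurableSet {s | f p s = f q s} := fun p q =>
    measurableSet_eq_fun (hf p) (hf q)
  have h0 : Measurable fun b : Loop k β => b 0 :=
    (continuous_eval_const (0 : AddCircle β)).measurable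
  let D : ℤ × ℕ → Set (ℤ → CellSample k) := fun p =>
    {s | p.2 < (s p.1).1} ∩ f p ⁻¹' ({b | b 0 ∈ slab k (Ico p.1 (p.1 + 1))} ∩ A)
  have hD : ∀ p, MeasurableSet (D p) := fun p => by
    refine MeasurableSet.inter ?_ (hf p ((h0 (measurable_fst measurableSet_Ico)).inter hA))
    exact measurableSet_lt measurable_const (measurable_fst.comp (measurable_pi_apply _))
  convert measurable_encard_range f D hD hE using 2 with s
  simp only [count, assemble]
  congr 1
  ext b
  simp only [mem_ofPred_eq, Prod.exists]
  constructor
  · rintro ⟨⟨i, j, hj, hb, hs⟩, hbA⟩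
    subst hb
    exact ⟨i, j, ⟨hj, hs, hbA⟩, rfl⟩
  · rintro ⟨i, j, ⟨hj, hs, hbA⟩, rfl⟩
    exact ⟨⟨i, j, hj, rfl, hs⟩, hbA⟩

instance instIsProbabilityMeasureCellLaw : IsProbabilityMeasure (cellLaw k) := by
  have : IsProbabilityMeasure ((volume : Measure (Cyl k)).restrict (slab k (Ico 0 1))) := by
    refine ⟨?_⟩
    have : slab k (Ico 0 1) = (Ico (0 : ℝ) 1) ×ˢ univ := by ext; simp [slab]
    rw [Measure.restrict_apply_univ, this, Measure.volume_eq_prod, Measure.prod_prod, volume_pi,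
      Measure.pi_univ]
    simp
  unfold cellLaw
  infer_instance

theorem isProbabilityMeasure_poissonLaw (hβ : 0 < β) : IsProbabilityMeasure (poissonLaw k β) := by
  have : Fact (0 < β) := ⟨hβ⟩
  exact Measure.isProbabilityMeasure_map measurable_assemble.aemeasurable

/-! ### Specific relative entropy -/

/-- The relative entropy per unit length in the box `Λ_N` with respect to the Poisson process. It is
`∞` if the restriction of `P` to the box is not absolutely continuous. -/
def boxEntropy (P : ProbabilityMeasure (Conf k β)) (N : ℕ) : ℝ≥0∞ :=
  InformationTheory.klDiv ((P : Measure (Conf k β)).map (proj (box k N)))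
    ((poissonLaw k β).map (proj (box k N))) / N

open scoped Classical in
/-- The specific relative entropy; it is `∞` on non-stationary laws. -/
def ent (P : ProbabilityMeasure (Conf k β)) : ℝ≥0∞ :=
  if IsStationary P then limUnder atTop (boxEntropy P) else ∞

/-! ### Electrostatics -/

/-- The Green's function of `-Δ` on `S`, `g(x, y) = -|x|/2 + ∑_{n ≠ 0} (2 √λ_n)⁻¹ exp(-|x| √λ_n)
cos(2π n ⬝ y)` with `n ∈ ℤ^k` and `√λ_n = 2π |n|`. -/
def green (z : Cyl k) : ℝ :=
  -|z.1| / 2 + ∑' n : Fin k → ℤ, if n = 0 then 0 else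
    (2 * (2 * Real.pi * √(∑ i, (n i : ℝ) ^ 2)))⁻¹ *
      Real.exp (-|z.1| * (2 * Real.pi * √(∑ i, (n i : ℝ) ^ 2))) * (∏ i, fourier (n i) (z.2 i)).re

/-- The potential `∫ g(z - z') δ^η_o(dz')` of a unit charge spread uniformly over the sphere of
radius `η` around the origin. -/
def smearedGreen (η : ℝ) (z : Cyl k) : ℝ :=
  ⨍ u : Metric.sphere (0 : EuclideanSpace ℝ (Fin (k + 1))) 1,
    green (z - wrap fun i => η * (u : EuclideanSpace ℝ (Fin (k + 1))) i)
    ∂(volume : Measure (EuclideanSpace ℝ (Fin (k + 1)))).toSphere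

/-- The electrostatic potential `V_t(z, ω, Λ)` at time `t` of the smeared charges `b(t)`, `b ∈ ω_Λ`,
and of the neutralizing background in `Λ`. -/
def potential (η : ℝ) (ω : Conf k β) (Λ : Set (Cyl k)) (t : ℝ) (z : Cyl k) : ℝ :=
  (∑ᶠ b ∈ (proj Λ ω).bridges, smearedGreen η (z - b (t : AddCircle β))) -
    ∫ z' in Λ, green (z - z')

/-- The squared length `|∇V(z)|²` of the gradient of a function on `S`, computed in the Euclidean
coordinates around `z`. -/
def gradSq (V : Cyl k → ℝ) (z : Cyl k) : ℝ≥0∞ :=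
  ‖fderiv ℝ (fun v : EuclideanSpace ℝ (Fin (k + 1)) => V (z + wrap fun i => v i)) 0‖ₑ ^ 2

/-- The energy `(2β)⁻¹ ∫_{K × [0, β]} |∇V_t(z, ω, Λ)|² d(z, t)`. -/
def fieldEnergy (η : ℝ) (ω : Conf k β) (Λ K : Set (Cyl k)) : ℝ≥0∞ :=
  ENNReal.ofReal (2 * β)⁻¹ *
    ∫⁻ p : Cyl k × ℝ in K ×ˢ Icc 0 β, gradSq (potential η ω Λ p.2) p.1

/-- Charge-neutral configurations in `Λ`: all bridges start in `Λ` and their number is `|Λ|`. -/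
def Neut (Λ : Set (Cyl k)) : Set (Conf k β) :=
  {ω | (∀ b ∈ ω.bridges, b 0 ∈ Λ) ∧ (ω.bridges.encard : ℝ≥0∞) = volume Λ}

/-- The eroded interval `I⁻` of `I = [l, r]`. -/
def eroded (l r : ℝ) : Set ℝ :=
  Icc (l + ⌈(r - l) ^ (7 / 8 : ℝ)⌉) (r - ⌈(r - l) ^ (7 / 8 : ℝ)⌉)

/-- `Θ(K)` for `K = [l, r] × D`: bridges starting outside `K` never visit `K⁻`. -/
def Theta (l r : ℝ) : Set (Conf k β) :=
  {ω | ∀ b ∈ ω.bridges, b 0 ∉ slab k (Icc l r) → ∀ t, b t ∉ slab k (eroded l r)}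

/-- The minimal energy content of the window `K = [l, r] × D`: the infimum of the field energy in
`K` over all `Λ = [p, q] × D ⊇ K` with `p, q ∈ ℤ` and all neutral configurations `ω'` in `Λ` that
belong to `Θ(K)` and agree with `ω` in `K`. -/
def minEnergy (η : ℝ) (l r : ℝ) (ω : Conf k β) : ℝ≥0∞ :=
  ⨅ (p : ℤ) (q : ℤ) (ω' : Conf k β) (_ : slab k (Icc l r) ⊆ slab k (Icc p q))
    (_ : ω' ∈ Neut (slab k (Icc (p : ℝ) q))) (_ : ω' ∈ Theta l r)
    (_ : proj (slab k (Icc l r)) ω' = proj (slab k (Icc l r)) ω),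
    fieldEnergy η ω' (slab k (Icc p q)) (slab k (Icc l r))

/-- The minimal energy depends on `ω` only through `ω_K`. -/
theorem minEnergy_proj (η l r : ℝ) (ω : Conf k β) :
    minEnergy η l r (proj (slab k (Icc l r)) ω) = minEnergy η l r ω := by
  have h : proj (slab k (Icc l r)) (proj (slab k (Icc l r)) ω) = proj (slab k (Icc l r)) ω := by
    ext b
    simp only [proj, mem_ofPred_eq]
    tauto
  unfold minEnergy
  rw [h]

/-- The expectation `E_P[(N⁻¹ H̃_{Λ_N}) ∧ M]` of the truncated energy density. The observable depends
on `ω` only through `ω_{Λ_N}` (see `minEnergy_proj`), so the expectation is written with respect to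
the restriction `P_{Λ_N}` of `P` to the box. -/
def boxEnergy (η : ℝ) (P : ProbabilityMeasure (Conf k β)) (M : ℝ≥0) (N : ℕ) : ℝ≥0∞ :=
  ∫⁻ ω, min (minEnergy η 0 N ω / N) M ∂(P : Measure (Conf k β)).map (proj (box k N))

/-- `W^M(P)`, the limit of the expected truncated energy densities. -/
def truncEnergy (η : ℝ) (P : ProbabilityMeasure (Conf k β)) (M : ℝ≥0) : ℝ≥0∞ :=
  limUnder atTop (boxEnergy η P M)

/-- The expected specific energy `W(P)`. -/
def energy (η : ℝ) (P : ProbabilityMeasure (Conf k β)) : ℝ≥0∞ :=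
  limUnder atTop (truncEnergy η P)

open scoped Classical in
/-- The free energy `F(P) = W(P) + β⁻¹ ent(P)` if `P` is stationary with finite specific relative
entropy, and `∞` otherwise. -/
def freeEnergy (η : ℝ) (P : ProbabilityMeasure (Conf k β)) : ℝ≥0∞ :=
  if IsStationary P ∧ ent P < ∞ then energy η P + ENNReal.ofReal β⁻¹ * ent P else ∞

end QuantumJellium

end

namespace QuantumJellium

/-! ### The Donsker–Varadhan formula -/

section DonskerVaradhan

open InformationTheory

variable {α : Type*} [MeasurableSpace α] {μ ν : Measure α}

/-! Entropy and truncated energy both come from box functionals that are lower semicontinuous and,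
at least approximately, superadditive in the box. Superadditivity yields the limits and bounds them
from below by finite-box values, which carries lower semicontinuity over to the limit.

Entropy. By the Donsker–Varadhan formula (`klDiv_eq_iSup`) the box entropy is a supremum of
functionals of `P` that test only bounded local observables, hence it is lower semicontinuous. The
Poisson process is shift invariant and independent over disjoint boxes, so test functions for two
adjacent boxes can be added (`boxKL_add_le`), and Fekete's lemma identifies the limit with the
supremum over boxes.

Energy. A competitor `ω'` for a long box is also a competitor for every block inside it that keeps
away from the boundary layer, provided that no bridge starting outside the block enters the eroded
block (`minEnergy_le_fieldEnergy`). Since field energies over disjoint blocks add up, the minimal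
energy is superadditive apart from blocks hit by a stray bridge; thanks to the truncation at `M`,
such a block of length `N` costs at most `N * M` (`sum_density_le`). Hence `boxEnergy η P M N` is at
most the limit plus `2 * M` times the expected `excess` at distance `layer N`
(`IsStationary.boxEnergy_le_liminf`).

Rarity of stray bridges. The supremum of a Brownian bridge has all exponential moments, so the
entropy inequality makes this error small for large `N`, uniformly over stationary laws with `ent P
≤ c` (`exists_mul_excess_layer_le`). This gives the limits, and also lower semicontinuity of the
truncated energy on entropy sublevel sets.

Free energy. Stationarity is a closed condition, and a law of large entropy has large free energy
anyway, so near a given law only an entropy sublevel set matters (`lowerSemicontinuous_freeEnergy`).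
Measurability of `minEnergy` is never needed: `lintegral` is a lower integral, and every estimate
uses only the inequalities that hold for it. -/

theorem integrable_of_abs_le [IsFiniteMeasure μ] {f : α → ℝ} (hf : Measurable f) {C : ℝ}
    (hC : ∀ x, |f x| ≤ C) : Integrable f μ :=
  Integrable.of_bound hf.aestronglyMeasurable C (ae_of_all _ hC)

theorem integrable_exp_of_abs_le [IsFiniteMeasure μ] {f : α → ℝ} (hf : Measurable f) {C : ℝ}
    (hC : ∀ x, |f x| ≤ C) : Integrable (fun x => Real.exp (f x)) μ := by
  refine integrable_of_abs_le hf.exp (C := Real.exp C) fun x => ?_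
  rw [Real.abs_exp]
  exact Real.exp_le_exp.2 (le_of_abs_le (hC x))

/-- Young's inequality for the convex function `klFun` and its conjugate `exp - 1`. -/
theorem mul_sub_exp_add_one_le_klFun {x : ℝ} (hx : 0 ≤ x) (y : ℝ) :
    x * y - Real.exp y + 1 ≤ klFun x := by
  rw [klFun_apply]
  rcases hx.eq_or_lt with rfl | hx
  · have := Real.exp_pos y
    simp [this.le]
  · have h1 := Real.add_one_le_exp (y - Real.log x)
    rw [Real.exp_sub, Real.exp_log hx, le_div_iff₀ hx] at h1
    nlinarith

theorem integral_add_one_sub_integral_exp [IsProbabilityMeasure μ] [IsProbabilityMeasure ν]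
    (h : μ ≪ ν) {f : α → ℝ} (hf : Measurable f) {C : ℝ} (hC : ∀ x, |f x| ≤ C) :
    Integrable (fun x => (μ.rnDeriv ν x).toReal * f x - Real.exp (f x) + 1) ν ∧
      ∫ x, ((μ.rnDeriv ν x).toReal * f x - Real.exp (f x) + 1) ∂ν =
        ∫ x, f x ∂μ - ∫ x, Real.exp (f x) ∂ν + 1 := by
  have h1 : Integrable (fun x => (μ.rnDeriv ν x).toReal * f x) ν :=
    (integrable_toReal_rnDeriv_mul_iff h).2 (integrable_of_abs_le hf hC)
  have h2 : Integrable (fun x => Real.exp (f x)) ν := integrable_exp_of_abs_le hf hC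
  refine ⟨(h1.sub h2).add (integrable_const _), ?_⟩
  have h3 := integral_add (h1.sub h2) (integrable_const (1 : ℝ))
  have h4 := integral_sub h1 h2
  simp only [Pi.sub_apply, integral_const, probReal_univ, smul_eq_mul, mul_one] at h3 h4
  rw [h3, h4, integral_toReal_rnDeriv_mul h]

theorem ofReal_integral_le_lintegral_ofReal {f : α → ℝ} (hf : Integrable f μ) :
    ENNReal.ofReal (∫ x, f x ∂μ) ≤ ∫⁻ x, ENNReal.ofReal (f x) ∂μ := by
  rw [integral_eq_lintegral_pos_part_sub_lintegral_neg_part hf]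
  exact (ENNReal.ofReal_le_ofReal (sub_le_self _ ENNReal.toReal_nonneg)).trans
    ENNReal.ofReal_toReal_le

/-- The left-hand functional does not change when a constant is added to `f`, so `f` may be
normalised to have exponential integral `1` under `ν`. Young's inequality at the density of `μ`,
integrated against `ν`, then gives the bound. -/
theorem ofReal_integral_sub_log_le_klDiv [IsProbabilityMeasure μ] [IsProbabilityMeasure ν]
    {f : α → ℝ} (hf : Measurable f) {C : ℝ} (hC : ∀ x, |f x| ≤ C) :
    ENNReal.ofReal (∫ x, f x ∂μ - Real.log (∫ x, Real.exp (f x) ∂ν)) ≤ klDiv μ ν := by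
  by_cases h : μ ≪ ν
  swap
  · simp [klDiv_of_not_ac h]
  have hpos : 0 < ∫ x, Real.exp (f x) ∂ν := integral_exp_pos (integrable_exp_of_abs_le hf hC)
  set c := Real.log (∫ x, Real.exp (f x) ∂ν) with hc
  have hf' : Measurable fun x => f x - c := hf.sub_const c
  have hC' : ∀ x, |f x - c| ≤ C + |c| := fun x => (abs_sub _ _).trans (by gcongr; exact hC x)
  obtain ⟨h1, h2⟩ := integral_add_one_sub_integral_exp h hf' hC'
  have h3 : ∫ x, Real.exp (f x - c) ∂ν = 1 := by
    simp_rw [Real.exp_sub]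
    rw [integral_div, hc, Real.exp_log hpos, div_self hpos.ne']
  rw [h3, integral_sub (integrable_of_abs_le hf hC) (integrable_const _)] at h2
  simp only [integral_const, probReal_univ, smul_eq_mul, one_mul, sub_add_cancel] at h2
  rw [← h2, klDiv_eq_lintegral_klFun_of_ac h]
  refine (ofReal_integral_le_lintegral_ofReal h1).trans (lintegral_mono fun x => ?_)
  exact ENNReal.ofReal_le_ofReal (mul_sub_exp_add_one_le_klFun ENNReal.toReal_nonneg _)

/-- Equality in Young's inequality holds at `y = log x`, so the logarithm of the density, truncated
to be bounded, is nearly optimal by Fatou's lemma. Without absolute continuity, a large multiple of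
the indicator of a `ν`-null set of positive `μ`-measure does it. -/
theorem exists_lt_ofReal_integral_sub_log [IsProbabilityMeasure μ] [IsProbabilityMeasure ν]
    {a : ℝ≥0∞} (ha : a < klDiv μ ν) :
    ∃ f : α → ℝ, Measurable f ∧ (∃ C : ℝ, ∀ x, |f x| ≤ C) ∧
      a < ENNReal.ofReal (∫ x, f x ∂μ - Real.log (∫ x, Real.exp (f x) ∂ν)) := by
  have ha' : a ≠ ∞ := (ha.trans_le le_top).ne
  by_cases h : μ ≪ ν
  · rw [klDiv_eq_lintegral_klFun_of_ac h] at ha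
    let ρ : α → ℝ := fun x => (μ.rnDeriv ν x).toReal
    have hρ : Measurable ρ := (Measure.measurable_rnDeriv _ _).ennreal_toReal
    let c : ℕ → α → ℝ := fun n x => max ((n + 1 : ℝ)⁻¹) (min (ρ x) (n + 1))
    let f : ℕ → α → ℝ := fun n x => Real.log (c n x)
    have hcpos : ∀ n x, 0 < c n x := fun n x => lt_max_of_lt_left (by positivity)
    have hf : ∀ n, Measurable (f n) := fun n =>
      (measurable_const.max (hρ.min measurable_const)).log
    have hC : ∀ n x, |f n x| ≤ Real.log (n + 1) := fun n x => by
      have h1 : ((n + 1 : ℝ)⁻¹) ≤ c n x := le_max_left _ _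
      have h2 : c n x ≤ n + 1 := by
        refine max_le ?_ (min_le_right _ _)
        exact (inv_le_one_of_one_le₀ (by linarith [n.cast_nonneg (α := ℝ)])).trans
          (by linarith [n.cast_nonneg (α := ℝ)])
      rw [abs_le, ← Real.log_inv]
      exact ⟨Real.log_le_log (by positivity) h1, Real.log_le_log (hcpos n x) h2⟩
    let g : ℕ → α → ℝ := fun n x => ρ x * f n x - Real.exp (f n x) + 1
    -- Nonnegativity allows the lower integral of `g n` to be read as its Bochner integral below.
    -- Where the density is truncated it has to be checked separately; elsewhere `g n x` is `klFun`
    -- of the density.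
    have hg0 : ∀ n x, 0 ≤ g n x := fun n x => by
      have hρ0 : 0 ≤ ρ x := ENNReal.toReal_nonneg
      have hn : (1 : ℝ) ≤ n + 1 := by linarith [n.cast_nonneg (α := ℝ)]
      have hn' : ((n + 1 : ℝ)⁻¹) ≤ 1 := inv_le_one_of_one_le₀ hn
      simp only [g, f, Real.exp_log (hcpos n x)]
      rcases le_total (ρ x) ((n + 1 : ℝ)⁻¹) with h1 | h1
      · have hc : c n x = (n + 1 : ℝ)⁻¹ := by
          simp only [c]; rw [min_eq_left (by linarith), max_eq_left h1]
        have h2 := Real.log_le_sub_one_of_pos (show (0 : ℝ) < n + 1 by positivity)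
        have h3 := Real.log_nonneg hn
        rw [hc, Real.log_inv]
        have h4 : ρ x * Real.log (n + 1) ≤ (n + 1 : ℝ)⁻¹ * ((n + 1) - 1) := by gcongr
        have h5 : (n + 1 : ℝ)⁻¹ * ((n + 1) - 1) = 1 - (n + 1 : ℝ)⁻¹ := by field_simp
        linarith
      · rcases le_total (ρ x) (n + 1) with h2 | h2
        · have hc : c n x = ρ x := by
            simp only [c]; rw [min_eq_left h2, max_eq_right h1]
          rw [hc]
          have := klFun_nonneg hρ0
          rw [klFun_apply] at this
          linarith
        · have hc : c n x = n + 1 := by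
            simp only [c]; rw [min_eq_right h2, max_eq_right (by linarith)]
          rw [hc]
          have := klFun_nonneg (show (0 : ℝ) ≤ n + 1 by positivity)
          rw [klFun_apply] at this
          have h3 := mul_le_mul_of_nonneg_right h2 (Real.log_nonneg hn)
          linarith
    have hlim : ∀ x, Tendsto (fun n => g n x) atTop (𝓝 (klFun (ρ x))) := fun x => by
      have hρ0 : 0 ≤ ρ x := ENNReal.toReal_nonneg
      rcases hρ0.eq_or_lt with h0 | h0
      · have h1 : ∀ n : ℕ, g n x = 1 - (n + 1 : ℝ)⁻¹ := fun n => by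
          have hc : c n x = (n + 1 : ℝ)⁻¹ := by
            simp only [c, ← h0]
            rw [min_eq_left (by positivity), max_eq_left (by positivity)]
          simp only [g, f]
          rw [Real.exp_log (hcpos n x), hc, ← h0]
          ring
        simp only [h1, ← h0, klFun_zero]
        have h2 : Tendsto (fun n : ℕ => (n + 1 : ℝ)⁻¹) atTop (𝓝 0) := by
          simpa using tendsto_one_div_add_atTop_nhds_zero_nat (𝕜 := ℝ)
        simpa using h2.const_sub 1
      · obtain ⟨m, hm⟩ := exists_nat_gt (max (ρ x) (ρ x)⁻¹)
        refine tendsto_const_nhds.congr' ?_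
        filter_upwards [eventually_ge_atTop m] with n hn
        have hn' : (m : ℝ) ≤ n := by exact_mod_cast hn
        have h1 : ρ x ≤ n + 1 := by linarith [le_max_left (ρ x) (ρ x)⁻¹]
        have h2 : (n + 1 : ℝ)⁻¹ ≤ ρ x := by
          apply inv_le_of_inv_le₀ h0
          linarith [le_max_right (ρ x) (ρ x)⁻¹]
        have hc : c n x = ρ x := by
          simp only [c]; rw [min_eq_left h1, max_eq_right h2]
        simp only [g, f]
        rw [Real.exp_log (hcpos n x), hc, klFun_apply]
        ring
    have hg : ∀ n, Measurable (g n) := fun n =>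
      ((hρ.mul (hf n)).sub (hf n).exp).add_const _
    have hfatou : ∫⁻ x, ENNReal.ofReal (klFun (ρ x)) ∂ν ≤
        liminf (fun n => ∫⁻ x, ENNReal.ofReal (g n x) ∂ν) atTop := by
      refine le_trans (lintegral_mono fun x => ?_)
        (lintegral_liminf_le fun n => (hg n).ennreal_ofReal)
      exact (((ENNReal.continuous_ofReal.tendsto _).comp (hlim x)).liminf_eq).ge
    obtain ⟨n, hn⟩ := (eventually_lt_of_lt_liminf (ha.trans_le hfatou)).exists
    refine ⟨f n, hf n, ⟨_, hC n⟩, hn.trans_le ?_⟩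
    obtain ⟨h1, h2⟩ := integral_add_one_sub_integral_exp h (hf n) (hC n)
    rw [← ofReal_integral_eq_lintegral_ofReal h1 (ae_of_all _ (hg0 n)), h2]
    refine ENNReal.ofReal_le_ofReal ?_
    -- `log x ≤ x - 1` passes from the Young form of the functional to the larger one with the
    -- logarithm.
    have := Real.log_le_sub_one_of_pos
      (integral_exp_pos (μ := ν) (integrable_exp_of_abs_le (hf n) (hC n)))
    linarith
  · obtain ⟨A, hA, hνA, hμA⟩ : ∃ A, MeasurableSet A ∧ ν A = 0 ∧ μ A ≠ 0 := by
      by_contra! hcon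
      exact h (Measure.AbsolutelyContinuous.mk hcon)
    have hpos : 0 < μ.real A := ENNReal.toReal_pos hμA (measure_ne_top _ _)
    -- The height is chosen so that the indicator has `μ`-integral `a + 1`.
    let c : ℝ := (a.toReal + 1) / μ.real A
    refine ⟨A.indicator fun _ => c, measurable_const.indicator hA, ⟨|c|, fun x => ?_⟩, ?_⟩
    · by_cases hx : x ∈ A <;> simp [hx]
    · have h1 : ∫ x, Real.exp (A.indicator (fun _ => c) x) ∂ν = 1 := by
        have : (fun x => Real.exp (A.indicator (fun _ => c) x)) =ᵐ[ν] fun _ => 1 := by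
          filter_upwards [measure_eq_zero_iff_ae_notMem.1 hνA] with x hx
          simp [hx]
        rw [integral_congr_ae this]
        simp
      rw [h1, integral_indicator_const _ hA, Real.log_one, sub_zero, smul_eq_mul,
        mul_div_cancel₀ _ hpos.ne', ENNReal.lt_ofReal_iff_toReal_lt ha']
      linarith

end DonskerVaradhan

variable {k : ℕ} {β : ℝ}

/-! ### Restrictions and shifts of configurations -/

theorem mem_proj {Λ : Set (Cyl k)} {ω : Conf k β} {b : Loop k β} :
    b ∈ (proj Λ ω).bridges ↔ b ∈ ω.bridges ∧ b 0 ∈ Λ := Iff.rfl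

theorem proj_proj (Λ Λ' : Set (Cyl k)) (ω : Conf k β) :
    proj Λ (proj Λ' ω) = proj (Λ' ∩ Λ) ω := by
  ext b
  simp only [mem_proj, mem_inter_iff]
  tauto

theorem translate_apply (w : Cyl k) (b : Loop k β) (t : AddCircle β) :
    translate w b t = b t + w := rfl

theorem translate_translate (v w : Cyl k) (b : Loop k β) :
    translate v (translate w b) = translate (w + v) b := by
  ext1 t
  simp only [translate_apply, add_assoc]

theorem translate_zero (b : Loop k β) : translate 0 b = b := by
  ext1 t
  simp only [translate_apply, add_zero]

theorem translate_injective (w : Cyl k) :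
    Function.Injective (translate w : Loop k β → Loop k β) := fun _ _ h => add_right_cancel h

theorem xVec_add (m n : ℤ) : xVec k (m + n) = xVec k m + xVec k n := by
  simp [xVec]

theorem mem_shift {n : ℤ} {ω : Conf k β} {b : Loop k β} :
    b ∈ (shift n ω).bridges ↔ translate (xVec k n) b ∈ ω.bridges := by
  constructor
  · rintro ⟨a, ha, rfl⟩
    rwa [translate_translate, neg_add_cancel, translate_zero]
  · intro h
    exact ⟨_, h, by rw [translate_translate, add_neg_cancel, translate_zero]⟩

theorem add_xVec_mem_slab {z : Cyl k} {n : ℤ} {I : Set ℝ} :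
    z + xVec k n ∈ slab k I ↔ z ∈ slab k ((fun x => x + (n : ℝ)) ⁻¹' I) := Iff.rfl

theorem proj_shift (n : ℤ) (I : Set ℝ) (ω : Conf k β) :
    proj (slab k ((fun x => x + (n : ℝ)) ⁻¹' I)) (shift n ω) = shift n (proj (slab k I) ω) := by
  ext b
  simp only [mem_proj, mem_shift, translate_apply, add_xVec_mem_slab]

theorem measurableSet_slab {I : Set ℝ} (hI : MeasurableSet I) : MeasurableSet (slab k I) :=
  measurable_fst hI

theorem measurable_eval_zero : Measurable fun b : Loop k β => b 0 :=
  (continuous_eval_const (0 : AddCircle β)).measurable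

/-! ### The Poisson process on cells -/

theorem translate_bridgeFrom (w z : Cyl k) (ξ : Fin (k + 1) → ℕ × ℕ → ℝ) :
    translate w (bridgeFrom β z ξ) = bridgeFrom β (z + w) ξ := by
  ext1 t
  simp only [translate_apply, bridgeFrom, ContinuousMap.coe_mk]
  abel

theorem mem_assemble {s : ℤ → CellSample k} {b : Loop k β} :
    b ∈ (assemble β s).bridges ↔ ∃ i : ℤ, ∃ j < (s i).1,
      b = bridgeFrom β (((s i).2 j).1 + xVec k i) ((s i).2 j).2 ∧ b 0 ∈ slab k (Ico i (i + 1)) :=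
  Iff.rfl

theorem shift_assemble (n : ℤ) (s : ℤ → CellSample k) :
    shift n (assemble β s) = assemble β fun i => s (i + n) := by
  ext b
  rw [mem_shift, mem_assemble, mem_assemble]
  have h1 : ∀ z : Cyl k, ∀ i ξ, translate (xVec k n) b = bridgeFrom β (z + xVec k (i + n)) ξ ↔
      b = bridgeFrom β (z + xVec k i) ξ := fun z i ξ => by
    rw [xVec_add, ← add_assoc, ← translate_bridgeFrom (xVec k n)]
    exact (translate_injective _).eq_iff
  have h2 : ∀ i : ℤ, translate (xVec k n) b 0 ∈ slab k (Ico ((i + n : ℤ) : ℝ) ((i + n : ℤ) + 1)) ↔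
      b 0 ∈ slab k (Ico (i : ℝ) (i + 1)) := fun i => by
    rw [translate_apply, add_xVec_mem_slab]
    simp only [slab, mem_ofPred_eq, mem_preimage, mem_Ico, Int.cast_add]
    constructor <;> rintro ⟨h, h'⟩ <;> constructor <;> linarith
  constructor
  · rintro ⟨i, j, hj, hb, h0⟩
    obtain ⟨i, rfl⟩ : ∃ i', i = i' + n := ⟨i - n, by ring⟩
    exact ⟨i, j, hj, (h1 _ _ _).1 hb, (h2 i).1 h0⟩
  · rintro ⟨i, j, hj, hb, h0⟩
    exact ⟨i + n, j, hj, (h1 _ _ _).2 hb, (h2 i).2 h0⟩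

/-- A shift by an integer only relabels the cells, and the product of identical cell laws is
invariant under relabelling. -/
theorem poissonLaw_map_shift [Fact (0 < β)] (n : ℤ) :
    (poissonLaw k β).map (shift n) = poissonLaw k β := by
  unfold poissonLaw
  rw [Measure.map_map (measurable_shift n) measurable_assemble]
  have h1 : shift n ∘ assemble β = (assemble β : (ℤ → CellSample k) → Conf k β) ∘
      fun s i => s (i + n) := funext fun s => shift_assemble n s
  rw [h1, ← Measure.map_map measurable_assemble (by fun_prop)]
  rw [Measure.map_infinitePi_infinitePi_of_inj (P := fun _ : ℤ => cellLaw k)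
    (f := fun i : ℤ => i + n) (add_left_injective n)]

/-- Extend a sample on finitely many cells by empty cells. -/
def extendSample (I : Finset ℤ) (s : I → CellSample k) : ℤ → CellSample k :=
  fun i => if h : i ∈ I then s ⟨i, h⟩ else (0, fun _ => (0, 0))

theorem measurable_extendSample (I : Finset ℤ) :
    Measurable (extendSample I : (I → CellSample k) → ℤ → CellSample k) := by
  refine measurable_pi_lambda _ fun i => ?_
  unfold extendSample
  by_cases h : i ∈ I
  · simp only [h, dite_true]; fun_prop
  · simp only [h, dite_false]; fun_prop

/-- The condition on `b 0` built into `assemble` forces each bridge to start in the cell that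
generated it, even for coefficients whose Lévy series diverges. So the identity holds for every
sample, and a half-open integer box sees only the samples of its own cells. -/
theorem proj_assemble (a b : ℤ) (s : ℤ → CellSample k) :
    proj (slab k (Ico (a : ℝ) b)) (assemble β s) =
      assemble β (extendSample (Finset.Ico a b) fun i => s i) := by
  ext c
  rw [mem_proj, mem_assemble, mem_assemble]
  constructor
  · rintro ⟨⟨i, j, hj, hb, h0⟩, h⟩
    have h1 : ((i : ℝ) ≤ (c 0).1 ∧ (c 0).1 < i + 1) := h0
    have h2 : ((a : ℝ) ≤ (c 0).1 ∧ (c 0).1 < b) := h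
    have hi : i ∈ Finset.Ico a b := by
      rw [Finset.mem_Ico, ← Int.lt_add_one_iff]
      constructor
      · exact_mod_cast h2.1.trans_lt h1.2
      · exact_mod_cast h1.1.trans_lt h2.2
    exact ⟨i, j, by simpa [extendSample, hi] using hj, by simpa [extendSample, hi] using hb, h0⟩
  · rintro ⟨i, j, hj, hb, h0⟩
    by_cases hi : i ∈ Finset.Ico a b
    · simp only [extendSample, hi, dite_true] at hj hb
      refine ⟨⟨i, j, hj, hb, h0⟩, ?_⟩
      have h1 : ((i : ℝ) ≤ (c 0).1 ∧ (c 0).1 < i + 1) := h0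
      rw [Finset.mem_Ico, ← Int.add_one_le_iff] at hi
      have h2 : (a : ℝ) ≤ i := by exact_mod_cast hi.1
      have h3 : (i : ℝ) + 1 ≤ b := by exact_mod_cast hi.2
      exact ⟨h2.trans h1.1, h1.2.trans_le h3⟩
    · simp [extendSample, hi] at hj

theorem indepFun_proj_assemble [Fact (0 < β)] (a b c : ℤ) :
    IndepFun (fun s => proj (slab k (Ico (a : ℝ) b)) (assemble β s))
      (fun s => proj (slab k (Ico (b : ℝ) c)) (assemble β s))
      (Measure.infinitePi fun _ : ℤ => cellLaw k) := by
  have h := (iIndepFun_infinitePi (P := fun _ : ℤ => cellLaw k) (X := fun _ x => x)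
    (fun _ => measurable_id)).indepFun_finset (Finset.Ico a b) (Finset.Ico b c)
    (Finset.Ico_disjoint_Ico_consecutive a b c) (fun _ => by fun_prop)
  have h' := h.comp
    (φ := fun x => assemble β (extendSample (Finset.Ico a b) x))
    (ψ := fun x => assemble β (extendSample (Finset.Ico b c) x))
    (measurable_assemble.comp (measurable_extendSample _))
    (measurable_assemble.comp (measurable_extendSample _))
  convert h' using 1
  · exact funext fun s => proj_assemble a b s
  · exact funext fun s => proj_assemble b c s

/-- The Poisson processes in disjoint boxes are independent. -/
theorem integral_mul_poissonLaw [Fact (0 < β)] (a b c : ℤ) {F G : Conf k β → ℝ}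
    (hF : Measurable F) (hG : Measurable G) :
    ∫ ω, F (proj (slab k (Ico (a : ℝ) b)) ω) * G (proj (slab k (Ico (b : ℝ) c)) ω)
        ∂poissonLaw k β =
      (∫ ω, F (proj (slab k (Ico (a : ℝ) b)) ω) ∂poissonLaw k β) *
        ∫ ω, G (proj (slab k (Ico (b : ℝ) c)) ω) ∂poissonLaw k β := by
  have hm : ∀ a b : ℤ, Measurable (proj (slab k (Ico (a : ℝ) b)) : Conf k β → Conf k β) :=
    fun a b => measurable_proj (measurableSet_slab measurableSet_Ico)
  have h1 : Measurable fun ω => F (proj (slab k (Ico (a : ℝ) b)) ω) := hF.comp (hm a b)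
  have h2 : Measurable fun ω => G (proj (slab k (Ico (b : ℝ) c)) ω) := hG.comp (hm b c)
  unfold poissonLaw
  rw [integral_map measurable_assemble.aemeasurable (by exact (h1.mul h2).aestronglyMeasurable),
    integral_map measurable_assemble.aemeasurable h1.aestronglyMeasurable,
    integral_map measurable_assemble.aemeasurable h2.aestronglyMeasurable]
  exact ((indepFun_proj_assemble a b c).comp hF hG).integral_fun_mul_eq_mul_integral
    (h1.comp measurable_assemble).aestronglyMeasurable
    (h2.comp measurable_assemble).aestronglyMeasurable

/-- The law of the mark attached to a point. -/
noncomputable def markLaw (k : ℕ) : Measure (Cyl k × (Fin (k + 1) → ℕ × ℕ → ℝ)) :=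
  (volume.restrict (slab k (Ico 0 1))).prod <|
    Measure.infinitePi fun _ => Measure.infinitePi fun _ => gaussianReal 0 1

instance instIsProbabilityMeasureUnitCell :
    IsProbabilityMeasure ((volume : Measure (Cyl k)).restrict (slab k (Ico 0 1))) := by
  refine ⟨?_⟩
  have : slab k (Ico 0 1) = (Ico (0 : ℝ) 1) ×ˢ univ := by ext; simp [slab]
  rw [Measure.restrict_apply_univ, this, Measure.volume_eq_prod, Measure.prod_prod, volume_pi,
    Measure.pi_univ]
  simp

instance instIsProbabilityMeasureMarkLaw : IsProbabilityMeasure (markLaw k) := by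
  unfold markLaw
  infer_instance

/-! ### Absence of starting points on a fixed cross-section -/

theorem cellLaw_eq : cellLaw k = (poissonMeasure 1).prod (Measure.infinitePi fun _ => markLaw k) :=
  rfl

theorem measurePreserving_mark (i : ℤ) (j : ℕ) :
    MeasurePreserving (fun s : ℤ → CellSample k => (s i).2 j)
      (Measure.infinitePi fun _ : ℤ => cellLaw k) (markLaw k) := by
  have h1 := measurePreserving_eval_infinitePi (fun _ : ℤ => cellLaw k) i
  have h2 : MeasurePreserving (Prod.snd : CellSample k → _) (cellLaw k)
    (Measure.infinitePi fun _ => markLaw k) := measurePreserving_snd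
  exact (measurePreserving_eval_infinitePi (fun _ : ℕ => markLaw k) j).comp (h2.comp h1)

/-- For fixed Gaussian coefficients the first coordinate of the starting point is a translate of a
uniform variable, which has no atoms. -/
theorem ae_markLaw_bridgeFrom_ne [Fact (0 < β)] (w : Cyl k) (c : ℝ) :
    ∀ᵐ p ∂markLaw k, (bridgeFrom β (p.1 + w) p.2 0).1 ≠ c := by
  have hm : Measurable fun p : Cyl k × (Fin (k + 1) → ℕ × ℕ → ℝ) =>
      (bridgeFrom β (p.1 + w) p.2 0).1 :=
    (measurable_eval_zero.comp (measurable_bridgeFrom.comp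
      ((measurable_fst.add_const w).prodMk measurable_snd))).fst
  have hs : MeasurableSet {p : Cyl k × (Fin (k + 1) → ℕ × ℕ → ℝ) |
      (bridgeFrom β (p.1 + w) p.2 0).1 = c} := hm (measurableSet_singleton c)
  have h0 : markLaw k {p | (bridgeFrom β (p.1 + w) p.2 0).1 = c} = 0 := by
    rw [markLaw, Measure.prod_apply_symm hs]
    refine (lintegral_congr fun ξ => ?_).trans lintegral_zero
    refine Measure.restrict_le_self.absolutelyContinuous ?_
    have : (fun x => (x, ξ)) ⁻¹' {p : Cyl k × (Fin (k + 1) → ℕ × ℕ → ℝ) |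
        (bridgeFrom β (p.1 + w) p.2 0).1 = c} ⊆
        ({c - w.1 - brownianBridge β (ξ 0) 0} : Set ℝ) ×ˢ univ := by
      intro z hz
      have : z.1 + w.1 + brownianBridge β (ξ 0) 0 = c := hz
      simp only [mem_prod, mem_singleton_iff, mem_univ, and_true]
      linarith
    refine measure_mono_null this ?_
    rw [Measure.volume_eq_prod, Measure.prod_prod]
    simp
  exact measure_eq_zero_iff_ae_notMem.1 h0

/-- Adjacent closed boxes share a cross-section; this makes the overlap negligible, so that
independence over half-open boxes applies to them. -/
theorem ae_poissonLaw_ne [Fact (0 < β)] (c : ℝ) :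
    ∀ᵐ ω ∂poissonLaw k β, ∀ b ∈ ω.bridges, (b 0).1 ≠ c := by
  have hB : MeasurableSet {b : Loop k β | (b 0).1 = c} :=
    measurable_eval_zero.fst (measurableSet_singleton c)
  have hset : {ω : Conf k β | ∀ b ∈ ω.bridges, (b 0).1 ≠ c} =
      count {b : Loop k β | (b 0).1 = c} ⁻¹' {0} := by
    ext ω
    simp only [mem_ofPred_eq, mem_preimage, mem_singleton_iff, count, encard_eq_zero,
      eq_empty_iff_forall_notMem, not_and]
  have hmeas : MeasurableSet {ω : Conf k β | ∀ b ∈ ω.bridges, (b 0).1 ≠ c} := by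
    rw [hset]
    exact measurable_count hB (measurableSet_singleton 0)
  unfold poissonLaw
  rw [ae_map_iff measurable_assemble.aemeasurable hmeas]
  have h : ∀ᵐ s ∂(Measure.infinitePi fun _ : ℤ => cellLaw k), ∀ i : ℤ, ∀ j : ℕ,
      (bridgeFrom β (((s i).2 j).1 + xVec k i) ((s i).2 j).2 0).1 ≠ c := by
    rw [ae_all_iff]
    intro i
    rw [ae_all_iff]
    intro j
    exact (measurePreserving_mark i j).quasiMeasurePreserving.ae
      (ae_markLaw_bridgeFrom_ne (xVec k i) c)
  filter_upwards [h] with s hs b hb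
  obtain ⟨i, j, -, rfl, -⟩ := hb
  exact hs i j

theorem proj_slab_Icc_of_ne {a b : ℝ} {ω : Conf k β} (h : ∀ c ∈ ω.bridges, (c 0).1 ≠ b) :
    proj (slab k (Icc a b)) ω = proj (slab k (Ico a b)) ω := by
  ext c
  simp only [mem_proj, slab, mem_ofPred_eq, mem_Icc, mem_Ico]
  exact ⟨fun hc => ⟨hc.1, hc.2.1, hc.2.2.lt_of_ne (h c hc.1)⟩,
    fun hc => ⟨hc.1, hc.2.1, hc.2.2.le⟩⟩

/-! ### Lévy's construction: exponential moments of the supremum of the Brownian bridge -/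

/-- Two different points of the grid of mesh `β / n` on the circle are at least one mesh apart: `d`
is not a multiple of `n`, so reducing modulo the period leaves at least one step. -/
theorem le_norm_coe_div_mul (hβ : 0 < β) {n : ℕ} {d : ℤ} (hd : d ≠ 0) (hdn : |d| < n) :
    β / n ≤ ‖((d / n * β : ℝ) : AddCircle β)‖ := by
  have hn : (0 : ℝ) < n := by
    have : 0 < n := by
      by_contra h
      have : n = 0 := by omega
      subst this
      exact absurd hdn (not_lt.2 (abs_nonneg d))
    exact_mod_cast this
  rw [AddCircle.norm_eq]
  set z := round (β⁻¹ * (d / n * β))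
  have h1 : (d / n * β : ℝ) - z * β = ((d - z * n : ℤ) : ℝ) * (β / n) := by
    push_cast
    field_simp
  have h2 : (d - z * n : ℤ) ≠ 0 := by
    intro h
    have h3 : (n : ℤ) ∣ d := ⟨z, by linarith⟩
    have h4 := Int.le_of_dvd (abs_pos.2 hd) ((dvd_abs _ _).2 h3)
    omega
  have h5 : (1 : ℝ) ≤ |((d - z * n : ℤ) : ℝ)| := by exact_mod_cast Int.one_le_abs h2
  rw [h1, abs_mul, abs_of_pos (show (0 : ℝ) < β / n by positivity)]
  exact le_mul_of_one_le_left (by positivity) h5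

/-- The tents of one level have disjoint supports. -/
theorem abs_sum_mul_hat_le (hβ : 0 < β) (j : ℕ) (a : ℕ → ℝ) {C : ℝ} (hC : 0 ≤ C)
    (ha : ∀ m < 2 ^ j, |a m| ≤ C) (t : AddCircle β) :
    |∑ m ∈ Finset.range (2 ^ j), a m * max 0 (1 - 2 ^ (j + 1) / β *
      ‖t - (((2 * m + 1) / 2 ^ (j + 1) * β : ℝ) : AddCircle β)‖)| ≤ C := by
  set h : ℕ → ℝ := fun m => max 0 (1 - 2 ^ (j + 1) / β *
      ‖t - (((2 * m + 1) / 2 ^ (j + 1) * β : ℝ) : AddCircle β)‖) with hh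
  by_cases hex : ∃ m ∈ Finset.range (2 ^ j), h m ≠ 0
  · obtain ⟨m, hm, hm0⟩ := hex
    have hclose : ∀ m, h m ≠ 0 →
        ‖t - (((2 * m + 1) / 2 ^ (j + 1) * β : ℝ) : AddCircle β)‖ < β / 2 ^ (j + 1) := by
      intro m hm
      by_contra! hcon
      apply hm
      simp only [hh]
      rw [max_eq_left]
      have := mul_le_mul_of_nonneg_left hcon (show 0 ≤ 2 ^ (j + 1) / β by positivity)
      have h1 : (2 ^ (j + 1) / β) * (β / 2 ^ (j + 1)) = 1 := by field_simp
      linarith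
    rw [Finset.sum_eq_single m]
    · rw [abs_mul]
      have h1 : |h m| ≤ 1 := by
        rw [abs_of_nonneg (le_max_left _ _)]
        refine max_le zero_le_one ?_
        have : 0 ≤ 2 ^ (j + 1) / β *
          ‖t - (((2 * m + 1) / 2 ^ (j + 1) * β : ℝ) : AddCircle β)‖ := by positivity
        linarith
      calc |a m| * |h m| ≤ C * 1 := by
            gcongr
            exact ha m (Finset.mem_range.1 hm)
        _ = C := mul_one C
    · intro m' hm' hne
      by_contra hcon
      have hm'0 : h m' ≠ 0 := right_ne_zero_of_mul hcon
      have h1 := hclose m hm0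
      have h2 := hclose m' hm'0
      have h3 : (((m : ℤ) - m' : ℤ) / ((2 ^ j : ℕ) : ℝ) * β : ℝ) =
          (2 * m + 1) / 2 ^ (j + 1) * β - (2 * m' + 1) / 2 ^ (j + 1) * β := by
        push_cast
        rw [pow_succ]
        field_simp
        ring
      -- Distinct centres are at least `β / 2 ^ j` apart, twice the radius of a tent, so `t` cannot
      -- lie in the open supports of both.
      have h4 := le_norm_coe_div_mul hβ (n := 2 ^ j) (d := (m : ℤ) - m')
        (by omega) (by
          rw [Finset.mem_range] at hm hm'
          rw [abs_lt]
          omega)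
      rw [h3, AddCircle.coe_sub, ← dist_eq_norm] at h4
      rw [← dist_eq_norm] at h1 h2
      have h5 := dist_triangle_left ((((2 * m + 1) / 2 ^ (j + 1) * β : ℝ) : AddCircle β))
        ((((2 * m' + 1) / 2 ^ (j + 1) * β : ℝ) : AddCircle β)) t
      have h6 : β / ((2 ^ j : ℕ) : ℝ) = β / 2 ^ (j + 1) + β / 2 ^ (j + 1) := by
        push_cast
        rw [pow_succ]
        field_simp
        ring
      linarith
    · exact fun h => absurd hm h
  · push Not at hex
    rw [Finset.sum_eq_zero fun m hm => mul_eq_zero_of_right _ (hex m hm)]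
    simpa

theorem norm_sum_smul_tent_le [Fact (0 < β)] (j : ℕ) (ξ : ℕ × ℕ → ℝ) {C : ℝ} (hC : 0 ≤ C)
    (h : ∀ m < 2 ^ j, |ξ (j, m)| ≤ C) :
    ‖∑ m ∈ Finset.range (2 ^ j), ξ (j, m) • tent β j m‖ ≤
      √β * (√(2 ^ j) / 2 ^ (j + 1)) * C := by
  rw [ContinuousMap.norm_le _ (by positivity)]
  intro t
  have h1 := abs_sum_mul_hat_le (Fact.out : 0 < β) j (fun m => ξ (j, m)) hC h t
  have h2 : (∑ m ∈ Finset.range (2 ^ j), ξ (j, m) • tent β j m) t =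
      √β * (√(2 ^ j) / 2 ^ (j + 1)) * ∑ m ∈ Finset.range (2 ^ j), ξ (j, m) *
      max 0 (1 - 2 ^ (j + 1) / β *
      ‖t - (((2 * m + 1) / 2 ^ (j + 1) * β : ℝ) : AddCircle β)‖) := by
    rw [ContinuousMap.sum_apply, Finset.mul_sum]
    refine Finset.sum_congr rfl fun m _ => ?_
    simp only [ContinuousMap.smul_apply, tent, ContinuousMap.coe_mk, smul_eq_mul]
    ring
  rw [h2, norm_mul, Real.norm_of_nonneg (by positivity)]
  exact mul_le_mul_of_nonneg_left h1 (by positivity)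

/-- The tent heights decay geometrically with ratio `√2 / 2`, which beats linear growth of the
coefficients. -/
theorem summable_schauder (β : ℝ) :
    Summable fun j : ℕ => √β * (√(2 ^ j) / 2 ^ (j + 1)) * (j + 1 : ℝ) := by
  have hr : ‖(√2 / 2 : ℝ)‖ < 1 := by
    rw [Real.norm_of_nonneg (by positivity), div_lt_one two_pos]
    exact (Real.sqrt_lt' two_pos).2 (by norm_num)
  have h1 := summable_pow_mul_geometric_of_norm_lt_one 1 hr
  have h2 := summable_geometric_of_norm_lt_one hr
  have h3 := (h1.add h2).mul_left (√β / 2)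
  refine h3.congr fun j => ?_
  have : √((2 : ℝ) ^ j) = √2 ^ j := by
    rw [Real.sqrt_eq_iff_mul_self_eq (by positivity) (by positivity), ← mul_pow,
      Real.mul_self_sqrt (by positivity)]
  rw [this, pow_succ, div_pow]
  ring

/-- Linear growth of the coefficients with the level controls the sum of the Lévy series. -/
theorem exists_norm_brownianBridge_le [Fact (0 < β)] :
    ∃ c : ℝ, 0 < c ∧ ∀ (ξ : ℕ × ℕ → ℝ) (x : ℝ), 0 ≤ x →
      (∀ j, ∀ m < 2 ^ j, |ξ (j, m)| ≤ c * (j + 1) * x) → ‖brownianBridge β ξ‖ ≤ x := by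
  set A := ∑' j : ℕ, √β * (√(2 ^ j) / 2 ^ (j + 1)) * (j + 1 : ℝ) with hA
  have hA0 : 0 ≤ A := tsum_nonneg fun j => by positivity
  refine ⟨(A + 1)⁻¹, by positivity, fun ξ x hx h => ?_⟩
  set f : ℕ → C(AddCircle β, ℝ) := fun j =>
    ∑ m ∈ Finset.range (2 ^ j), ξ (j, m) • tent β j m with hf
  have hle : ∀ j, ‖f j‖ ≤ √β * (√(2 ^ j) / 2 ^ (j + 1)) * (j + 1 : ℝ) * ((A + 1)⁻¹ * x) := by
    intro j
    refine (norm_sum_smul_tent_le j ξ (by positivity) (h j)).trans (le_of_eq ?_)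
    ring
  have hs := (summable_schauder β).mul_right ((A + 1)⁻¹ * x)
  have hsf : Summable f := Summable.of_norm_bounded hs hle
  have hlim : brownianBridge β ξ = ∑' j, f j := hsf.hasSum.tendsto_sum_nat.limUnder_eq
  rw [hlim]
  refine (tsum_of_norm_bounded hs.hasSum hle).trans ?_
  rw [tsum_mul_right, ← hA, ← mul_assoc]
  refine mul_le_of_le_one_left hx ?_
  rw [← div_eq_mul_inv, div_le_one (by positivity)]
  linarith

/-- An integrable majorant `T` replaces a tail estimate. With `x = log T / κ`, each summand of `T`
being at most `T` forces all coefficients below the linear profile of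
`exists_norm_brownianBridge_le`, so the norm is at most `x`. The majorant is integrable because the
`2 ^ j` terms of level `j` carry the weight `exp (-(j + 1))` and `2 / e < 1`. -/
theorem lintegral_exp_norm_brownianBridge_lt_top [Fact (0 < β)] (κ : ℝ) (hκ : 0 < κ) :
    ∫⁻ ξ, ENNReal.ofReal (Real.exp (κ * ‖brownianBridge β ξ‖))
      ∂(Measure.infinitePi fun _ : ℕ × ℕ => gaussianReal 0 1) < ∞ := by
  obtain ⟨c, hc, hB⟩ := exists_norm_brownianBridge_le (β := β)
  -- The excess `1 / c` of the rate over `κ / c` absorbs the weight `exp (-(j + 1))` for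
  -- coefficients of size at least `c * (j + 1)`. Smaller ones are harmless once `1 ≤ x`, which the
  -- summand `exp κ` of `T` ensures.
  let e : ℝ → ℝ≥0∞ := fun u => ENNReal.ofReal (Real.exp ((κ + 1) / c * |u|))
  have he : Measurable e := by fun_prop
  let T : (ℕ × ℕ → ℝ) → ℝ≥0∞ := fun ξ => ENNReal.ofReal (Real.exp κ) +
    ∑' j : ℕ, ∑ m ∈ Finset.range (2 ^ j), e (ξ (j, m)) * ENNReal.ofReal (Real.exp (-(j + 1)))
  have hT : ∀ ξ, ENNReal.ofReal (Real.exp (κ * ‖brownianBridge β ξ‖)) ≤ T ξ := by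
    intro ξ
    by_cases htop : T ξ = ∞
    · simp [htop]
    have h1 : Real.exp κ ≤ (T ξ).toReal := by
      rw [← ENNReal.ofReal_le_iff_le_toReal htop]
      exact le_self_add
    have hpos : 0 < (T ξ).toReal := (Real.exp_pos _).trans_le h1
    set x := Real.log (T ξ).toReal / κ with hx
    have hx1 : 1 ≤ x := by
      rw [hx, le_div_iff₀ hκ, one_mul, Real.le_log_iff_exp_le hpos]
      exact h1
    have h2 : ‖brownianBridge β ξ‖ ≤ x := by
      refine hB ξ x (by linarith) fun j m hm => ?_
      have hj : (0 : ℝ) < j + 1 := by positivity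
      rcases le_total |ξ (j, m)| (c * (j + 1)) with h3 | h3
      · exact h3.trans (le_mul_of_one_le_right (by positivity) hx1)
      · have h4 : e (ξ (j, m)) * ENNReal.ofReal (Real.exp (-(j + 1))) ≤ T ξ := by
          refine le_trans ?_ le_add_self
          refine le_trans ?_ (ENNReal.le_tsum j)
          exact Finset.single_le_sum
            (f := fun m => e (ξ (j, m)) * ENNReal.ofReal (Real.exp (-(j + 1))))
            (fun _ _ => zero_le) (Finset.mem_range.2 hm)
        rw [← ENNReal.ofReal_mul (Real.exp_nonneg _), ← Real.exp_add,
          ENNReal.ofReal_le_iff_le_toReal htop, ← Real.le_log_iff_exp_le hpos] at h4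
        have h5 : Real.log (T ξ).toReal = x * κ := by rw [hx]; field_simp
        rw [h5] at h4
        set u := |ξ (j, m)|
        have h6 : j + 1 ≤ u / c := by rw [le_div_iff₀ hc]; linarith
        have h7 : (κ + 1) / c * u = κ * (u / c) + u / c := by ring
        have h8 : κ * (u / c) ≤ κ * x := by linarith
        have h9 : u / c ≤ x := le_of_mul_le_mul_left h8 hκ
        rw [div_le_iff₀ hc] at h9
        have hj1 : (1 : ℝ) ≤ j + 1 := by linarith [j.cast_nonneg (α := ℝ)]
        have h10 : x * c ≤ c * (j + 1) * x := by
          have := le_mul_of_one_le_right (show 0 ≤ x * c by positivity) hj1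
          linarith
        linarith
    refine ENNReal.ofReal_le_of_le_toReal ?_
    rw [← Real.le_log_iff_exp_le hpos]
    have h5 : Real.log (T ξ).toReal = κ * x := by rw [hx]; field_simp
    rw [h5]
    gcongr
  refine (lintegral_mono hT).trans_lt ?_
  have hG : ∫⁻ u, e u ∂gaussianReal 0 1 < ∞ := by
    have := integrable_exp_mul_abs (μ := gaussianReal 0 1) (X := id) (t := (κ + 1) / c)
      (integrable_exp_mul_gaussianReal _) (integrable_exp_mul_gaussianReal _)
    exact this.lintegral_lt_top
  set G := ∫⁻ u, e u ∂gaussianReal 0 1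
  have hterm : ∀ p : ℕ × ℕ, ∫⁻ ξ, e (ξ p)
      ∂(Measure.infinitePi fun _ : ℕ × ℕ => gaussianReal 0 1) = G := fun p =>
    (measurePreserving_eval_infinitePi (fun _ : ℕ × ℕ => gaussianReal 0 1) p).lintegral_comp he
  have hmeas : ∀ p : ℕ × ℕ, Measurable fun ξ : ℕ × ℕ → ℝ => e (ξ p) := fun p =>
    he.comp (measurable_pi_apply p)
  rw [lintegral_add_left measurable_const, lintegral_tsum fun j => (Finset.measurable_fun_sum _
    fun m _ => (hmeas _).mul_const _).aemeasurable, lintegral_const, measure_univ, mul_one]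
  refine ENNReal.add_lt_top.2 ⟨ENNReal.ofReal_lt_top, ?_⟩
  have hsum : ∀ j : ℕ, ∫⁻ ξ, ∑ m ∈ Finset.range (2 ^ j), e (ξ (j, m)) *
      ENNReal.ofReal (Real.exp (-(j + 1))) ∂(Measure.infinitePi fun _ : ℕ × ℕ => gaussianReal 0 1) =
      G * ENNReal.ofReal (Real.exp (-1) * (2 * Real.exp (-1)) ^ j) := by
    intro j
    rw [lintegral_finsetSum _ fun m _ => (hmeas _).mul_const _]
    simp_rw [lintegral_mul_const _ (hmeas _), hterm]
    rw [Finset.sum_const, Finset.card_range, nsmul_eq_mul, mul_left_comm]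
    congr 1
    rw [mul_pow, ← Real.exp_nat_mul, mul_left_comm, ← Real.exp_add,
      ENNReal.ofReal_mul (by positivity), ENNReal.ofReal_pow (by positivity)]
    simp only [Nat.cast_pow, Nat.cast_ofNat, ENNReal.ofReal_ofNat]
    congr 3
    ring
  simp_rw [hsum]
  rw [ENNReal.tsum_mul_left]
  refine ENNReal.mul_lt_top hG ?_
  have h2e : 2 * Real.exp (-1) < 1 := by
    rw [Real.exp_neg, ← div_eq_mul_inv, div_lt_one (Real.exp_pos 1)]
    linarith [Real.exp_one_gt_d9]
  have hs := (summable_geometric_of_lt_one (by positivity) h2e).mul_left (Real.exp (-1))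
  rw [← ENNReal.ofReal_tsum_of_nonneg (fun j => by positivity) hs]
  exact ENNReal.ofReal_lt_top

section

/-! ### Bridges that travel far -/

/-- The displacement of a bridge from its starting point in the `x`-direction. -/
def displacement (b : Loop k β) : C(AddCircle β, ℝ) where
  toFun t := (b t).1 - (b 0).1
  continuous_toFun := by fun_prop

theorem continuous_displacement :
    Continuous (displacement : Loop k β → C(AddCircle β, ℝ)) := by
  refine ContinuousMap.continuous_of_continuous_uncurry _ ?_
  have h : ∀ f : Loop k β × AddCircle β → AddCircle β, Continuous f →
      Continuous fun x : Loop k β × AddCircle β => (x.1 (f x)).1 := fun f hf => by fun_prop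
  exact (h _ continuous_snd).sub (h _ continuous_const)

theorem displacement_translate (w : Cyl k) (b : Loop k β) :
    displacement (translate w b) = displacement b := by
  ext t
  simp [displacement, translate_apply]

theorem measurable_count_toENNReal {A : Set (Loop k β)} (hA : MeasurableSet A) :
    Measurable fun ω : Conf k β => (count A ω : ℝ≥0∞) :=
  (Measurable.of_discrete (f := ENat.toENNReal)).comp (measurable_count hA)

theorem count_proj_le (A : Set (Loop k β)) (Λ : Set (Cyl k)) (ω : Conf k β) :
    count A (proj Λ ω) ≤ count A ω :=
  encard_le_encard fun _ hb => ⟨hb.1.1, hb.2⟩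

/-- Only the sample of cell `0` can contribute. An inequality suffices, and it spares any argument
about equal bridges, which merge in a set. -/
theorem count_assemble_le (s : ℤ → CellSample k) (A : Set (Loop k β))
    (hA : A ⊆ {b | b 0 ∈ slab k (Ico 0 1)}) [DecidablePred (· ∈ A)] :
    (count A (assemble β s) : ℝ≥0∞) ≤ ∑ j ∈ Finset.range (s 0).1,
      if bridgeFrom β ((s 0).2 j).1 ((s 0).2 j).2 ∈ A then 1 else 0 := by
  classical
  let f : ℕ → Loop k β := fun j => bridgeFrom β ((s 0).2 j).1 ((s 0).2 j).2
  have hsub : {b | b ∈ (assemble β s).bridges ∧ b ∈ A} ⊆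
      ↑(((Finset.range (s 0).1).filter fun j => f j ∈ A).image f) := by
    rintro b ⟨⟨i, j, hj, hb, h0⟩, hbA⟩
    have h1 : ((i : ℝ) ≤ (b 0).1 ∧ (b 0).1 < i + 1) := h0
    have h2 : ((0 : ℝ) ≤ (b 0).1 ∧ (b 0).1 < 1) := hA hbA
    have hi : i = 0 := by
      have h3 : (i : ℝ) < 1 := h1.1.trans_lt h2.2
      have h4 : (0 : ℝ) < i + 1 := h2.1.trans_lt h1.2
      have h5 : i < 1 := by exact_mod_cast h3
      have h6 : 0 < i + 1 := by exact_mod_cast h4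
      omega
    subst hi
    have hbf : b = f j := by
      rw [hb, show xVec k 0 = 0 by simp [xVec], add_zero]
    simp only [Finset.coe_image, Finset.coe_filter, Finset.mem_range, mem_image, mem_ofPred_eq]
    exact ⟨j, ⟨hj, hbf ▸ hbA⟩, hbf.symm⟩
  have h1 := (encard_le_encard hsub).trans_eq (encard_coe_eq_coe_finsetCard _)
  have h2 : count A (assemble β s) ≤ (((Finset.range (s 0).1).filter fun j => f j ∈ A).card : ℕ∞) :=
    h1.trans (by exact_mod_cast Finset.card_image_le)
  calc (count A (assemble β s) : ℝ≥0∞)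
      ≤ (((Finset.range (s 0).1).filter fun j => f j ∈ A).card : ℝ≥0∞) := by
        have := ENat.toENNReal_le.2 h2
        simpa using this
    _ = _ := by
        rw [Finset.card_filter]
        push_cast
        rfl

/-! ### Exponential moments over one Poisson cell -/

theorem measurable_prod_range {h : Cyl k × (Fin (k + 1) → ℕ × ℕ → ℝ) → ℝ≥0∞} (hh : Measurable h) :
    Measurable fun q : CellSample k => ∏ j ∈ Finset.range q.1, h (q.2 j) := by
  refine measurable_from_prod_countable_right fun n => ?_
  have h1 : ∀ j, Measurable fun x : ℕ → Cyl k × (Fin (k + 1) → ℕ × ℕ → ℝ) => h (x j) :=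
    fun j => hh.comp (measurable_pi_apply j)
  exact Finset.measurable_fun_prod (Finset.range n) fun j _ => h1 j

/-- Given the number `n` of points, the marks are independent and the product has mean at most `(1 +
δ) ^ n`; the generating function of the Poisson law of mean `1` at `1 + δ` is `exp δ`. -/
theorem lintegral_prod_cellLaw {h : Cyl k × (Fin (k + 1) → ℕ × ℕ → ℝ) → ℝ≥0∞} (hh : Measurable h)
    {δ : ℝ} (hδ : 0 ≤ δ) (hle : ∫⁻ p, h p ∂markLaw k ≤ ENNReal.ofReal (1 + δ)) :
    ∫⁻ q, ∏ j ∈ Finset.range q.1, h (q.2 j) ∂cellLaw k ≤ ENNReal.ofReal (Real.exp δ) := by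
  have hm := measurable_prod_range hh
  have hind : iIndepFun (fun (j : ℕ) (x : ℕ → Cyl k × (Fin (k + 1) → ℕ × ℕ → ℝ)) => h (x j))
      (Measure.infinitePi fun _ : ℕ => markLaw k) :=
    iIndepFun_infinitePi (P := fun _ : ℕ => markLaw k) (X := fun _ => h) fun _ => hh
  have hn : ∀ n : ℕ, ∫⁻ x, ∏ j ∈ Finset.range n, h (x j)
      ∂(Measure.infinitePi fun _ : ℕ => markLaw k) ≤ ENNReal.ofReal ((1 + δ) ^ n) := by
    intro n
    rw [lintegral_prod_eq_prod_lintegral_of_indepFun _ _ hind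
      fun j => hh.comp (measurable_pi_apply j)]
    have h1 : ∀ j : ℕ, ∫⁻ x, h (x j) ∂(Measure.infinitePi fun _ : ℕ => markLaw k) =
        ∫⁻ p, h p ∂markLaw k := fun j =>
      (measurePreserving_eval_infinitePi (fun _ : ℕ => markLaw k) j).lintegral_comp hh
    simp_rw [h1]
    rw [Finset.prod_const, Finset.card_range, ENNReal.ofReal_pow (by positivity)]
    gcongr
  rw [cellLaw_eq, lintegral_prod _ hm.aemeasurable]
  refine (lintegral_mono hn).trans ?_
  rw [lintegral_countable']
  simp_rw [poissonMeasure_singleton]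
  have h2 : ∀ n : ℕ, ENNReal.ofReal ((1 + δ) ^ n) * ENNReal.ofReal
      (Real.exp (-((1 : ℝ≥0) : ℝ)) * ((1 : ℝ≥0) : ℝ) ^ n / (n.factorial : ℝ)) =
      ENNReal.ofReal (Real.exp (-1) * ((1 + δ) ^ n / n.factorial)) := by
    intro n
    rw [← ENNReal.ofReal_mul (by positivity)]
    congr 1
    simp
    ring
  simp_rw [h2]
  have h3 := (NormedSpace.expSeries_div_hasSum_exp (1 + δ)).mul_left (Real.exp (-1))
  rw [← Real.exp_eq_exp_ℝ, ← Real.exp_add, neg_add_cancel_left] at h3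
  rw [← ENNReal.ofReal_tsum_of_nonneg (fun n => by positivity) h3.summable, h3.tsum_eq]

/-- The bridges starting over `I` whose `x`-displacement reaches the distance `r`. -/
def farLoops (k : ℕ) (β : ℝ) [Fact (0 < β)] (I : Set ℝ) (r : ℕ) : Set (Loop k β) :=
  {b | b 0 ∈ slab k I ∧ (r : ℝ) ≤ ‖displacement b‖}

variable [Fact (0 < β)]

theorem measurableSet_farLoops {I : Set ℝ} (hI : MeasurableSet I) (r : ℕ) :
    MeasurableSet (farLoops k β I r) :=
  (measurable_eval_zero (measurableSet_slab hI)).inter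
    (measurableSet_le measurable_const continuous_displacement.norm.measurable)

/-- The sum over the bridges `b` of a configuration starting over `I` of the number of integers
`d ≥ r` that are at most the displacement of `b`. -/
noncomputable def excess (I : Set ℝ) (r : ℕ) (ω : Conf k β) : ℝ≥0∞ :=
  ∑' m : ℕ, (count (farLoops k β I (m + r)) ω : ℝ≥0∞)

theorem measurable_excess {I : Set ℝ} (hI : MeasurableSet I) (r : ℕ) :
    Measurable (excess I r : Conf k β → ℝ≥0∞) :=
  Measurable.tsum fun _ => measurable_count_toENNReal (measurableSet_farLoops hI _)

theorem count_farLoops_shift (I : Set ℝ) (r : ℕ) (n : ℤ) (ω : Conf k β) :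
    count (farLoops k β ((fun x => x + (n : ℝ)) ⁻¹' I) r) (shift n ω) =
      count (farLoops k β I r) ω := by
  rw [count, count, ← (translate_injective (xVec k n)).encard_image]
  congr 1
  ext b
  simp only [mem_image, mem_ofPred_eq, mem_shift, farLoops]
  constructor
  · rintro ⟨a, ⟨h1, h2, h3⟩, rfl⟩
    exact ⟨h1, h2, by rwa [displacement_translate]⟩
  · rintro ⟨h1, h2, h3⟩
    refine ⟨translate (-xVec k n) b, ⟨?_, ?_, ?_⟩, ?_⟩
    · rwa [translate_translate, neg_add_cancel, translate_zero]
    · rw [← add_xVec_mem_slab, ← translate_apply, translate_translate, neg_add_cancel,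
        translate_zero]
      exact h2
    · rwa [displacement_translate]
    · rw [translate_translate, neg_add_cancel, translate_zero]

theorem excess_proj {I J : Set ℝ} (h : I ⊆ J) (r : ℕ) (ω : Conf k β) :
    excess I r (proj (slab k J) ω) = excess I r ω := by
  have hc : ∀ m, count (farLoops k β I m) (proj (slab k J) ω) = count (farLoops k β I m) ω := by
    intro m
    unfold count
    congr 1
    ext b
    exact ⟨fun hb => ⟨hb.1.1, hb.2⟩, fun hb => ⟨⟨hb.1, h hb.2.1⟩, hb.2⟩⟩
  simp only [excess, hc]

/-- The factor `2` avoids using that the Brownian bridge vanishes at time `0`, which is not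
guaranteed when the Lévy series diverges. -/
theorem norm_displacement_bridgeFrom_le (z : Cyl k) (ξ : Fin (k + 1) → ℕ × ℕ → ℝ) :
    ‖displacement (bridgeFrom β z ξ)‖ ≤ 2 * ‖brownianBridge β (ξ 0)‖ := by
  rw [ContinuousMap.norm_le _ (by positivity)]
  intro t
  have h : displacement (bridgeFrom β z ξ) t =
      brownianBridge β (ξ 0) t - brownianBridge β (ξ 0) 0 := by
    simp [displacement, bridgeFrom, wrap]
  rw [h, two_mul]
  exact (norm_sub_le _ _).trans
    (add_le_add (ContinuousMap.norm_coe_le_norm _ _) (ContinuousMap.norm_coe_le_norm _ _))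

theorem lintegral_exp_displacement_lt_top (κ : ℝ) (hκ : 0 < κ) :
    ∫⁻ p, ENNReal.ofReal (Real.exp (κ * ‖displacement (bridgeFrom β p.1 p.2)‖)) ∂markLaw k < ∞ := by
  have h := lintegral_exp_norm_brownianBridge_lt_top (β := β) (κ * 2) (by positivity)
  have hB : Measurable fun ξ => ENNReal.ofReal (Real.exp (κ * 2 * ‖brownianBridge β ξ‖)) := by
    let : MeasurableSpace C(AddCircle β, ℝ) := borel _
    have : BorelSpace C(AddCircle β, ℝ) := ⟨rfl⟩
    have := (measurable_brownianBridge (β := β)).norm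
    fun_prop
  refine lt_of_le_of_lt ?_ h
  have hmp : MeasurePreserving (fun p : Cyl k × (Fin (k + 1) → ℕ × ℕ → ℝ) => p.2 0) (markLaw k)
      (Measure.infinitePi fun _ : ℕ × ℕ => gaussianReal 0 1) :=
    (measurePreserving_eval_infinitePi (fun _ : Fin (k + 1) =>
      Measure.infinitePi fun _ : ℕ × ℕ => gaussianReal 0 1) 0).comp measurePreserving_snd
  rw [← hmp.lintegral_comp hB]
  refine lintegral_mono fun p => ENNReal.ofReal_le_ofReal (Real.exp_le_exp.2 ?_)
  have := norm_displacement_bridgeFrom_le (β := β) p.1 p.2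
  rw [mul_assoc]
  gcongr

theorem tsum_indicator_le (d : ℝ) (r : ℕ) :
    ∑' m : ℕ, (if ((m + r : ℕ) : ℝ) ≤ d then 1 else 0 : ℝ≥0∞) ≤
      ENNReal.ofReal (if (r : ℝ) ≤ d then d + 1 else 0) := by
  by_cases h : (r : ℝ) ≤ d
  · have hd : 0 ≤ d := r.cast_nonneg.trans h
    rw [if_pos h, tsum_eq_sum (s := Finset.range (⌊d⌋₊ + 1))]
    · refine (Finset.sum_le_card_nsmul _ _ 1 fun m _ => by split_ifs <;> simp).trans ?_
      rw [Finset.card_range, nsmul_eq_mul, mul_one, ← ENNReal.ofReal_natCast]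
      refine ENNReal.ofReal_le_ofReal ?_
      push_cast
      linarith [Nat.floor_le hd]
    · intro m hm
      rw [Finset.mem_range, not_lt] at hm
      rw [if_neg]
      have := Nat.lt_of_floor_lt (Nat.lt_of_succ_le hm)
      push_cast
      linarith [r.cast_nonneg (α := ℝ)]
  · rw [if_neg h, ENNReal.ofReal_zero, nonpos_iff_eq_zero, ENNReal.tsum_eq_zero]
    intro m
    rw [if_neg]
    push_cast
    linarith [m.cast_nonneg (α := ℝ)]

theorem excess_assemble_le (s : ℤ → CellSample k) (r : ℕ) :
    excess (Ico 0 1) r (assemble β s) ≤ ∑ j ∈ Finset.range (s 0).1,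
      ENNReal.ofReal (if (r : ℝ) ≤ ‖displacement (bridgeFrom β ((s 0).2 j).1 ((s 0).2 j).2)‖
        then ‖displacement (bridgeFrom β ((s 0).2 j).1 ((s 0).2 j).2)‖ + 1 else 0) := by
  classical
  unfold excess
  refine (ENNReal.tsum_le_tsum fun m => count_assemble_le s _ fun b hb => hb.1).trans ?_
  rw [Summable.tsum_finsetSum fun _ _ => ENNReal.summable]
  refine Finset.sum_le_sum fun j _ => le_trans (ENNReal.tsum_le_tsum fun m => ?_)
    (tsum_indicator_le _ r)
  split_ifs with h1 h2 h2
  · exact le_rfl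
  · exact absurd h1.2 h2
  · exact zero_le
  · exact le_rfl

/-- The exponential moments of the excess of one cell under the Poisson law tend to one. -/
theorem exists_lintegral_exp_excess_le (k : ℕ) (β : ℝ) [Fact (0 < β)] (lam : ℝ) (hlam : 0 < lam) :
    ∃ C : ℝ, 0 ≤ C ∧ ∀ r n : ℕ, ∫⁻ ω : Conf k β,
      ENNReal.ofReal (Real.exp (lam * (min (excess (Ico 0 1) r ω) n).toReal)) ∂poissonLaw k β ≤
        ENNReal.ofReal (Real.exp (C * Real.exp (-r))) := by
  have hfin := lintegral_exp_displacement_lt_top (k := k) (β := β) (lam + 1) (by positivity)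
  let D : Cyl k × (Fin (k + 1) → ℕ × ℕ → ℝ) → ℝ := fun p => ‖displacement (bridgeFrom β p.1 p.2)‖
  have hD : Measurable D := continuous_displacement.norm.measurable.comp measurable_bridgeFrom
  set E := ∫⁻ p, ENNReal.ofReal (Real.exp ((lam + 1) * D p)) ∂markLaw k with hE
  refine ⟨Real.exp lam * E.toReal, by positivity, fun r n => ?_⟩
  -- A bridge contributes only if `r ≤ D p`, and then `lam * (D p + 1) ≤ lam - r + (lam + 1) * D p`:
  -- one unit more in the exponential rate buys the factor `exp (-r)`.
  let h : Cyl k × (Fin (k + 1) → ℕ × ℕ → ℝ) → ℝ≥0∞ := fun p =>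
    1 + ENNReal.ofReal (Real.exp (lam - r)) * ENNReal.ofReal (Real.exp ((lam + 1) * D p))
  have hh : Measurable h := by fun_prop
  have hint : ∫⁻ p, h p ∂markLaw k ≤
      ENNReal.ofReal (1 + Real.exp lam * E.toReal * Real.exp (-r)) := by
    rw [lintegral_add_left measurable_const, lintegral_const_mul _ (by fun_prop), ← hE]
    rw [lintegral_const, measure_univ, mul_one, ENNReal.ofReal_add zero_le_one (by positivity),
      ENNReal.ofReal_one, sub_eq_add_neg, Real.exp_add, mul_right_comm,
      ENNReal.ofReal_mul (p := _ * _) (by positivity), ENNReal.ofReal_toReal hfin.ne]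
  have hpt : ∀ s : ℤ → CellSample k,
      ENNReal.ofReal (Real.exp (lam * (min (excess (Ico 0 1) r (assemble β s)) n).toReal)) ≤
        ∏ j ∈ Finset.range (s 0).1, h ((s 0).2 j) := by
    intro s
    let w : ℕ → ℝ := fun j => if (r : ℝ) ≤ D ((s 0).2 j) then D ((s 0).2 j) + 1 else 0
    have hw0 : ∀ j, 0 ≤ w j := fun j => by
      simp only [w]
      split_ifs
      · positivity
      · exact le_rfl
    have h1 : (min (excess (Ico 0 1) r (assemble β s)) n).toReal ≤
        ∑ j ∈ Finset.range (s 0).1, w j := by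
      refine ENNReal.toReal_le_of_le_ofReal (Finset.sum_nonneg fun j _ => hw0 j) ?_
      rw [ENNReal.ofReal_sum_of_nonneg fun j _ => hw0 j]
      exact (min_le_left _ _).trans (excess_assemble_le s r)
    have h2 : Real.exp (lam * (min (excess (Ico 0 1) r (assemble β s)) n).toReal) ≤
        ∏ j ∈ Finset.range (s 0).1, Real.exp (lam * w j) := by
      rw [← Real.exp_sum, ← Finset.mul_sum]
      exact Real.exp_le_exp.2 (by gcongr)
    refine (ENNReal.ofReal_le_ofReal h2).trans ?_
    rw [ENNReal.ofReal_prod_of_nonneg fun j _ => (Real.exp_pos _).le]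
    refine Finset.prod_le_prod' fun j _ => ?_
    simp only [w, h]
    split_ifs with hr
    · refine le_trans ?_ le_add_self
      rw [← ENNReal.ofReal_mul (by positivity), ← Real.exp_add]
      exact ENNReal.ofReal_le_ofReal (Real.exp_le_exp.2 (by linarith))
    · simp
  have hmeas : Measurable fun ω : Conf k β =>
      ENNReal.ofReal (Real.exp (lam * (min (excess (Ico 0 1) r ω) n).toReal)) := by
    have := measurable_excess (k := k) (β := β) (measurableSet_Ico (a := (0 : ℝ)) (b := 1)) r
    fun_prop
  rw [poissonLaw, lintegral_map hmeas measurable_assemble]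
  refine (lintegral_mono hpt).trans ?_
  have hmp := measurePreserving_eval_infinitePi (fun _ : ℤ => cellLaw k) 0
  have hm := measurable_prod_range hh
  rw [hmp.lintegral_comp hm]
  exact lintegral_prod_cellLaw hh (by positivity) hint

end

section

/-! ### Limits of almost superadditive sequences -/

/-- Shared end of both superadditivity arguments: `κ L` is the fraction of the length `L` covered by
blocks, `x` the density in one block, and `e` an error independent of `L`. -/
theorem le_liminf_add_of_mul_le {v κ : ℕ → ℝ≥0∞} {x e : ℝ≥0∞} (hκ : Tendsto κ atTop (𝓝 1))
    (h : ∀ᶠ L in atTop, κ L * x ≤ v L + e) : x ≤ liminf v atTop + e := by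
  have h1 : Tendsto (fun L => κ L * x) atTop (𝓝 (1 * x)) :=
    ENNReal.Tendsto.mul_const hκ (Or.inl one_ne_zero)
  rw [one_mul] at h1
  have h2 : (fun a => a + e) (liminf v atTop) = liminf ((fun a => a + e) ∘ v) atTop :=
    Monotone.map_liminf_of_continuousAt (fun _ _ hab => add_le_add_left hab e) v
      (continuous_id.add continuous_const).continuousAt
  calc x = liminf (fun L => κ L * x) atTop := h1.liminf_eq.symm
    _ ≤ liminf ((fun a => a + e) ∘ v) atTop := liminf_le_liminf h
    _ = liminf v atTop + e := h2.symm

theorem tendsto_ofReal_div_of_le {a : ℕ → ℝ} {b : ℕ → ℝ} (h1 : ∀ L, a L ≤ L)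
    (h2 : ∀ L, L - b L ≤ a L) (hb : Tendsto (fun L => b L / L) atTop (𝓝 0)) :
    Tendsto (fun L : ℕ => ENNReal.ofReal (a L / L)) atTop (𝓝 1) := by
  rw [← ENNReal.ofReal_one]
  refine (ENNReal.continuous_ofReal.tendsto 1).comp ?_
  have h3 : Tendsto (fun L : ℕ => 1 - b L / L) atTop (𝓝 1) := by simpa using hb.const_sub 1
  refine tendsto_of_tendsto_of_tendsto_of_le_of_le' h3 tendsto_const_nhds ?_ ?_
  · filter_upwards [eventually_gt_atTop 0] with L hL
    have hL' : (0 : ℝ) < L := by exact_mod_cast hL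
    rw [le_div_iff₀ hL', sub_mul, one_mul, div_mul_cancel₀ _ hL'.ne']
    exact h2 L
  · filter_upwards [eventually_gt_atTop 0] with L hL
    have hL' : (0 : ℝ) < L := by exact_mod_cast hL
    rw [div_le_one hL']
    exact h1 L

/-- Fekete's argument in `[0, ∞]`: `L / N` copies of the block fit into length `L`, and the
remainder is dropped because `u` is nonnegative. Infinite values cause no trouble. -/
theorem div_le_liminf_of_superadditive {u : ℕ → ℝ≥0∞} (h : ∀ m n, u m + u n ≤ u (m + n)) {N : ℕ}
    (hN : 0 < N) : u N / N ≤ liminf (fun L => u L / L) atTop := by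
  have hN' : (N : ℝ≥0∞) ≠ 0 := by exact_mod_cast hN.ne'
  have h1 : ∀ q : ℕ, q * u N ≤ u (q * N) := by
    intro q
    induction q with
    | zero => simp
    | succ q ih =>
      push_cast
      rw [add_mul, one_mul, Nat.succ_mul]
      exact (add_le_add_left ih _).trans (h _ _)
  have h2 : ∀ L, (L / N : ℕ) * u N ≤ u L := by
    intro L
    refine (h1 (L / N)).trans ?_
    conv_rhs => rw [← Nat.div_add_mod' L N]
    exact le_self_add.trans (h _ _)
  have hκ : Tendsto (fun L : ℕ => ENNReal.ofReal (((L / N * N : ℕ) : ℝ) / L)) atTop (𝓝 1) := by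
    refine tendsto_ofReal_div_of_le (b := fun _ => N) (fun L => ?_) (fun L => ?_)
      (tendsto_const_div_atTop_nhds_zero_nat _)
    · exact_mod_cast Nat.div_mul_le_self L N
    · have h3 := Nat.div_add_mod' L N
      have h4 := Nat.mod_lt L hN
      have h5 : L ≤ L / N * N + N := by omega
      have : (L : ℝ) ≤ (L / N * N : ℕ) + N := by exact_mod_cast h5
      linarith
  have h3 := le_liminf_add_of_mul_le (v := fun L => u L / L) (x := u N / N) (e := 0) hκ (by
    filter_upwards [eventually_gt_atTop 0] with L hL
    have hL' : (0 : ℝ) < L := by exact_mod_cast hL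
    rw [add_zero, ENNReal.ofReal_div_of_pos hL', ENNReal.ofReal_natCast, ENNReal.ofReal_natCast]
    calc ((L / N * N : ℕ) : ℝ≥0∞) / L * (u N / N)
        = ((L / N : ℕ) * u N) / L * (N / N) := by
          push_cast
          simp only [div_eq_mul_inv]
          ring
      _ = ((L / N : ℕ) * u N) / L := by
          rw [ENNReal.div_self hN' (ENNReal.natCast_ne_top N), mul_one]
      _ ≤ u L / L := by gcongr; exact h2 L)
  simpa using h3

theorem tendsto_div_of_superadditive {u : ℕ → ℝ≥0∞} (h : ∀ m n, u m + u n ≤ u (m + n)) :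
    Tendsto (fun n => u n / n) atTop (𝓝 (⨆ (n : ℕ) (_ : 0 < n), u n / n)) := by
  refine tendsto_of_le_liminf_of_limsup_le (iSup₂_le fun n hn =>
    div_le_liminf_of_superadditive h hn) ?_
  refine limsup_le_of_le (by isBoundedDefault) ?_
  filter_upwards [eventually_gt_atTop 0] with n hn
  exact le_iSup₂_of_le n hn le_rfl

/-! ### The specific relative entropy -/

open InformationTheory

/-- Bounded measurable functions. -/
def BddMeasurable (α : Type*) [MeasurableSpace α] : Type _ :=
  {f : α → ℝ // Measurable f ∧ ∃ C : ℝ, ∀ x, |f x| ≤ C}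

instance instNonemptyBddMeasurable {α : Type*} [MeasurableSpace α] : Nonempty (BddMeasurable α) :=
  ⟨⟨fun _ => 0, measurable_const, 0, by simp⟩⟩

/-- The Donsker–Varadhan variational formula. -/
theorem klDiv_eq_iSup {α : Type*} [MeasurableSpace α] (μ ν : Measure α) [IsProbabilityMeasure μ]
    [IsProbabilityMeasure ν] :
    klDiv μ ν = ⨆ f : BddMeasurable α,
      ENNReal.ofReal (∫ x, f.1 x ∂μ - Real.log (∫ x, Real.exp (f.1 x) ∂ν)) := by
  refine le_antisymm (le_of_forall_lt fun a ha => ?_) (iSup_le fun f => ?_)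
  · obtain ⟨f, hf, hC, h⟩ := exists_lt_ofReal_integral_sub_log ha
    exact h.trans_le (le_iSup (fun f : BddMeasurable α =>
      ENNReal.ofReal (∫ x, f.1 x ∂μ - Real.log (∫ x, Real.exp (f.1 x) ∂ν))) ⟨f, hf, hC⟩)
  · obtain ⟨C, hC⟩ := f.2.2
    exact ofReal_integral_sub_log_le_klDiv f.2.1 hC

theorem measurableSet_box (k N : ℕ) : MeasurableSet (box k N) := measurableSet_slab measurableSet_Icc

theorem measurable_proj_box (N : ℕ) : Measurable (proj (box k N) : Conf k β → Conf k β) :=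
  measurable_proj (measurableSet_box k N)

theorem proj_box_shift (n : ℤ) (N : ℕ) (ω : Conf k β) :
    proj (box k N) (shift n ω) = shift n (proj (slab k (Icc (n : ℝ) (n + N))) ω) := by
  rw [← proj_shift, box]
  congr 2
  ext x
  simp only [mem_Icc, mem_preimage]
  constructor <;> rintro ⟨h, h'⟩ <;> constructor <;> linarith

theorem slab_inter (I J : Set ℝ) : slab k I ∩ slab k J = slab k (I ∩ J) := rfl

theorem proj_proj_slab {I J : Set ℝ} (h : I ⊆ J) (ω : Conf k β) :
    proj (slab k I) (proj (slab k J) ω) = proj (slab k I) ω := by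
  rw [proj_proj, slab_inter, inter_eq_self_of_subset_right h]

theorem proj_box_shift_proj_box {n : ℤ} {N L : ℕ} (h0 : 0 ≤ n) (h : n + N ≤ L) (ω : Conf k β) :
    proj (box k N) (shift n (proj (box k L) ω)) = proj (box k N) (shift n ω) := by
  rw [proj_box_shift, proj_box_shift, box, proj_proj_slab]
  refine Icc_subset_Icc (by exact_mod_cast h0) (by exact_mod_cast h)

theorem isProbabilityMeasure_map_proj (P : Measure (Conf k β)) [IsProbabilityMeasure P] (N : ℕ) :
    IsProbabilityMeasure (P.map (proj (box k N))) :=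
  Measure.isProbabilityMeasure_map (measurable_proj_box N).aemeasurable

theorem IsStationary.integral_shift {P : ProbabilityMeasure (Conf k β)} (hP : IsStationary P)
    (n : ℤ) {f : Conf k β → ℝ} (hf : Measurable f) :
    ∫ ω, f (shift n ω) ∂(P : Measure (Conf k β)) = ∫ ω, f ω ∂(P : Measure (Conf k β)) := by
  conv_rhs => rw [← hP n]
  rw [integral_map (measurable_shift n).aemeasurable hf.aestronglyMeasurable]

/-- The relative entropy in the box of length `N`. -/
noncomputable def boxKL (P : ProbabilityMeasure (Conf k β)) (N : ℕ) : ℝ≥0∞ :=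
  klDiv ((P : Measure (Conf k β)).map (proj (box k N))) ((poissonLaw k β).map (proj (box k N)))

/-- Almost surely no bridge starts on the common cross-section `x = M` or at the right end, so the
closed boxes may be replaced by disjoint half-open ones. Independence and shift invariance of the
Poisson law then factorise the integral. -/
theorem integral_exp_add_poissonLaw [Fact (0 < β)] (M N : ℕ) {f g : Conf k β → ℝ}
    (hf : Measurable f) (hg : Measurable g) :
    ∫ ω, Real.exp (f (proj (box k M) ω) + g (proj (box k N) (shift M ω))) ∂poissonLaw k β =
      (∫ ω, Real.exp (f (proj (box k M) ω)) ∂poissonLaw k β) *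
        ∫ ω, Real.exp (g (proj (box k N) ω)) ∂poissonLaw k β := by
  have h1 : ∀ᵐ ω ∂poissonLaw k β, proj (box k M) ω =
      proj (slab k (Ico ((0 : ℤ) : ℝ) ((M : ℤ) : ℝ))) ω := by
    filter_upwards [ae_poissonLaw_ne (M : ℝ)] with ω hω
    rw [box, proj_slab_Icc_of_ne hω]
    simp
  have h2 : ∀ᵐ ω ∂poissonLaw k β, proj (box k N) (shift M ω) =
      shift M (proj (slab k (Ico ((M : ℤ) : ℝ) ((M + N : ℤ) : ℝ))) ω) := by
    filter_upwards [ae_poissonLaw_ne (M + N : ℝ)] with ω hω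
    rw [proj_box_shift]
    simp only [Int.cast_natCast, Int.cast_add]
    rw [proj_slab_Icc_of_ne hω]
  have h3 : ∫ ω, Real.exp (g (proj (box k N) ω)) ∂poissonLaw k β =
      ∫ ω, Real.exp (g (proj (box k N) (shift M ω))) ∂poissonLaw k β := by
    conv_lhs => rw [← poissonLaw_map_shift (M : ℤ)]
    rw [integral_map (measurable_shift _).aemeasurable]
    exact (hg.comp (measurable_proj_box N)).exp.aestronglyMeasurable
  have h4 := integral_mul_poissonLaw (k := k) (β := β) 0 M (M + N)
    (F := fun ω => Real.exp (f ω)) (G := fun ω => Real.exp (g (shift M ω))) hf.exp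
    (hg.comp (measurable_shift _)).exp
  rw [h3]
  convert h4 using 1
  · refine integral_congr_ae ?_
    filter_upwards [h1, h2] with ω hω hω'
    rw [hω, hω', Real.exp_add]
  · congr 1
    · refine integral_congr_ae ?_
      filter_upwards [h1] with ω hω
      rw [hω]
    · refine integral_congr_ae ?_
      filter_upwards [h2] with ω hω
      rw [hω]

/-- The test function for the union is the sum of `f` in the first box and the shifted `g` in the
second. Its mean under `P` splits by linearity and stationarity, its log-exponential moment by
independence; `P` itself need not be independent over boxes. -/
theorem ofReal_add_le_boxKL [Fact (0 < β)] {P : ProbabilityMeasure (Conf k β)}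
    (hP : IsStationary P) (M N : ℕ) (f g : BddMeasurable (Conf k β)) :
    ENNReal.ofReal
      ((∫ ω, f.1 ω ∂(P : Measure (Conf k β)).map (proj (box k M)) -
        Real.log (∫ ω, Real.exp (f.1 ω) ∂(poissonLaw k β).map (proj (box k M)))) +
      (∫ ω, g.1 ω ∂(P : Measure (Conf k β)).map (proj (box k N)) -
        Real.log (∫ ω, Real.exp (g.1 ω) ∂(poissonLaw k β).map (proj (box k N))))) ≤
      boxKL P (M + N) := by
  obtain ⟨f, hf, C, hC⟩ := f
  obtain ⟨g, hg, C', hC'⟩ := g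
  dsimp only
  have := isProbabilityMeasure_poissonLaw (k := k) (β := β) Fact.out
  have := isProbabilityMeasure_map_proj (P : Measure (Conf k β)) (M + N)
  have := isProbabilityMeasure_map_proj (poissonLaw k β) (M + N)
  let h : Conf k β → ℝ := fun ω => f (proj (box k M) ω) + g (proj (box k N) (shift M ω))
  have hfM : Measurable fun ω : Conf k β => f (proj (box k M) ω) := hf.comp (measurable_proj_box M)
  have hgN' : Measurable fun ω : Conf k β => g (proj (box k N) ω) :=
    hg.comp (measurable_proj_box N)
  have hgN : Measurable fun ω : Conf k β => g (proj (box k N) (shift M ω)) :=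
    hgN'.comp (measurable_shift M)
  have hh : Measurable h := hfM.add hgN
  have hloc : ∀ ω, h (proj (box k (M + N)) ω) = h ω := by
    intro ω
    simp only [h]
    rw [proj_box_shift_proj_box (by positivity) (by push_cast; rfl), box, box, proj_proj_slab]
    exact Icc_subset_Icc le_rfl (by push_cast; linarith [N.cast_nonneg (α := ℝ)])
  refine le_trans (le_of_eq ?_) (ofReal_integral_sub_log_le_klDiv hh (C := C + C')
    fun ω => (abs_add_le _ _).trans (add_le_add (hC _) (hC' _)))
  have hpos : ∀ {u : Conf k β → ℝ} {C : ℝ}, Measurable u → (∀ ω, |u ω| ≤ C) →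
      0 < ∫ ω, Real.exp (u ω) ∂poissonLaw k β := fun hu hC =>
    integral_exp_pos (integrable_exp_of_abs_le hu hC)
  have hproj : ∀ N, AEMeasurable (proj (box k N)) (P : Measure (Conf k β)) :=
    fun N => (measurable_proj_box N).aemeasurable
  have hproj' : ∀ N, AEMeasurable (proj (box k N)) (poissonLaw k β) :=
    fun N => (measurable_proj_box N).aemeasurable
  rw [integral_map (hproj _) hf.aestronglyMeasurable, integral_map (hproj _) hg.aestronglyMeasurable,
    integral_map (hproj _) hh.aestronglyMeasurable,
    integral_map (hproj' _) hf.exp.aestronglyMeasurable,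
    integral_map (hproj' _) hg.exp.aestronglyMeasurable,
    integral_map (hproj' _) hh.exp.aestronglyMeasurable]
  simp only [hloc]
  simp only [h]
  rw [integral_exp_add_poissonLaw M N hf hg,
    Real.log_mul (hpos hfM fun ω => hC _).ne' (hpos hgN' fun ω => hC' _).ne',
    integral_add (integrable_of_abs_le hfM fun ω => hC _) (integrable_of_abs_le hgN fun ω => hC' _),
    hP.integral_shift M hgN']
  congr 1
  ring

theorem boxKL_add_le [Fact (0 < β)] {P : ProbabilityMeasure (Conf k β)} (hP : IsStationary P)
    (M N : ℕ) : boxKL P M + boxKL P N ≤ boxKL P (M + N) := by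
  have := isProbabilityMeasure_poissonLaw (k := k) (β := β) Fact.out
  have := fun N => isProbabilityMeasure_map_proj (P : Measure (Conf k β)) N
  have := fun N => isProbabilityMeasure_map_proj (poissonLaw k β) N
  let Φ : ℕ → BddMeasurable (Conf k β) → ℝ := fun N f =>
    ∫ ω, f.1 ω ∂(P : Measure (Conf k β)).map (proj (box k N)) -
        Real.log (∫ ω, Real.exp (f.1 ω) ∂(poissonLaw k β).map (proj (box k N)))
  have h0 : ∀ N, Φ N ⟨fun _ => 0, measurable_const, 0, by simp⟩ = 0 := fun N => by
    simp [Φ]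
  -- `ENNReal.ofReal` is additive only on nonnegative numbers, so test functions with negative value
  -- are replaced by the zero function.
  have hmax : ∀ N f, ∃ f', Φ N f' = max (Φ N f) 0 := fun N f => by
    rcases le_total (Φ N f) 0 with h | h
    · exact ⟨_, (h0 N).trans (max_eq_right h).symm⟩
    · exact ⟨f, (max_eq_left h).symm⟩
  have h1 : ∀ N, boxKL P N = ⨆ f, ENNReal.ofReal (Φ N f) := fun N => klDiv_eq_iSup _ _
  rw [h1 M, h1 N]
  refine ENNReal.iSup_add_iSup_le fun f g => ?_
  obtain ⟨f', hf'⟩ := hmax M f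
  obtain ⟨g', hg'⟩ := hmax N g
  refine le_trans ?_ (ofReal_add_le_boxKL hP M N f' g')
  change _ ≤ ENNReal.ofReal (Φ M f' + Φ N g')
  rw [hf', hg', ENNReal.ofReal_add (le_max_right _ _) (le_max_right _ _)]
  exact add_le_add (ENNReal.ofReal_le_ofReal (le_max_left _ _))
    (ENNReal.ofReal_le_ofReal (le_max_left _ _))

theorem tendsto_boxEntropy_iSup [Fact (0 < β)] {P : ProbabilityMeasure (Conf k β)}
    (hP : IsStationary P) :
    Tendsto (boxEntropy P) atTop (𝓝 (⨆ (n : ℕ) (_ : 0 < n), boxEntropy P n)) :=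
  tendsto_div_of_superadditive (boxKL_add_le hP)

theorem IsStationary.ent_eq [Fact (0 < β)] {P : ProbabilityMeasure (Conf k β)}
    (hP : IsStationary P) : ent P = ⨆ (n : ℕ) (_ : 0 < n), boxEntropy P n := by
  rw [ent, if_pos hP]
  exact (tendsto_boxEntropy_iSup hP).limUnder_eq

theorem IsStationary.tendsto_boxEntropy [Fact (0 < β)] {P : ProbabilityMeasure (Conf k β)}
    (hP : IsStationary P) : Tendsto (boxEntropy P) atTop (𝓝 (ent P)) := by
  rw [hP.ent_eq]
  exact tendsto_boxEntropy_iSup hP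

theorem IsStationary.boxEntropy_le_ent [Fact (0 < β)] {P : ProbabilityMeasure (Conf k β)}
    (hP : IsStationary P) {N : ℕ} (hN : 0 < N) : boxEntropy P N ≤ ent P := by
  rw [hP.ent_eq]
  exact le_iSup₂_of_le N hN le_rfl

/-! ### Continuity in the `τ`-topology -/

theorem isBounded_slab_Icc (k : ℕ) (a b : ℝ) : Bornology.IsBounded (slab k (Icc a b)) := by
  have h : slab k (Icc a b) = Icc a b ×ˢ univ := by ext; simp [slab]
  rw [h]
  exact (isCompact_Icc.prod isCompact_univ).isBounded

theorem continuous_integral_of_isBoundedLocal {f : Conf k β → ℝ} (hf : IsBoundedLocal f) :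
    Continuous fun P : ProbabilityMeasure (Conf k β) => ∫ ω, f ω ∂(P : Measure (Conf k β)) :=
  continuous_iff_le_induced.2 (iInf₂_le f hf)

theorem isBoundedLocal_comp_proj {f : Conf k β → ℝ} (hf : Measurable f) {C : ℝ}
    (hC : ∀ ω, |f ω| ≤ C) (a b : ℝ) :
    IsBoundedLocal fun ω => f (proj (slab k (Icc a b)) ω) := by
  refine ⟨hf.comp (measurable_proj (measurableSet_slab measurableSet_Icc)), ⟨C, fun ω => hC _⟩,
    slab k (Icc a b), isBounded_slab_Icc k a b, fun ω => ?_⟩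
  dsimp only
  rw [proj_proj, inter_self]

theorem continuous_integral_map_proj {f : Conf k β → ℝ} (hf : Measurable f) {C : ℝ}
    (hC : ∀ ω, |f ω| ≤ C) (N : ℕ) :
    Continuous fun P : ProbabilityMeasure (Conf k β) =>
      ∫ ω, f ω ∂(P : Measure (Conf k β)).map (proj (box k N)) := by
  have h : ∀ P : ProbabilityMeasure (Conf k β),
      ∫ ω, f ω ∂(P : Measure (Conf k β)).map (proj (box k N)) =
        ∫ ω, f (proj (box k N) ω) ∂(P : Measure (Conf k β)) := fun P =>
    integral_map (measurable_proj_box N).aemeasurable hf.aestronglyMeasurable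
  simp only [h]
  exact continuous_integral_of_isBoundedLocal (isBoundedLocal_comp_proj hf hC _ _)

/-- In the Donsker–Varadhan formula `P` enters only through expectations of bounded local
observables, so the box entropy is a supremum of continuous functions of `P`. -/
theorem lowerSemicontinuous_boxEntropy [Fact (0 < β)] {N : ℕ} (hN : 0 < N) :
    LowerSemicontinuous fun P : ProbabilityMeasure (Conf k β) => boxEntropy P N := by
  have := isProbabilityMeasure_poissonLaw (k := k) (β := β) Fact.out
  have := isProbabilityMeasure_map_proj (poissonLaw k β) N
  have h : ∀ P : ProbabilityMeasure (Conf k β), boxEntropy P N = ⨆ f : BddMeasurable (Conf k β),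
      ENNReal.ofReal (∫ ω, f.1 ω ∂(P : Measure (Conf k β)).map (proj (box k N)) -
        Real.log (∫ ω, Real.exp (f.1 ω) ∂(poissonLaw k β).map (proj (box k N)))) / N := by
    intro P
    have := isProbabilityMeasure_map_proj (P : Measure (Conf k β)) N
    rw [boxEntropy, klDiv_eq_iSup, ENNReal.iSup_div]
  simp only [h]
  refine lowerSemicontinuous_iSup fun f => Continuous.lowerSemicontinuous ?_
  obtain ⟨C, hC⟩ := f.2.2
  refine (ENNReal.continuous_div_const _ (by exact_mod_cast hN.ne')).comp
    (ENNReal.continuous_ofReal.comp ?_)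
  exact (continuous_integral_map_proj f.2.1 hC N).sub continuous_const

/-! ### Long bridges are rare under laws of bounded entropy -/

/-- The entropy inequality: `lam` times the mean under `P` is at most the relative entropy plus the
logarithm of the exponential moment under the Poisson law. Truncation at `n` makes the test function
bounded; the unit box suffices, since the excess looks only at bridges starting over `[0, 1)`. -/
theorem lintegral_min_excess_le [Fact (0 < β)] {P : ProbabilityMeasure (Conf k β)} {c C lam : ℝ}
    (hlam : 0 < lam) {r : ℕ} (n : ℕ)
    (hP : boxEntropy P 1 ≤ ENNReal.ofReal c) (hc : 0 ≤ c)
    (hC : ∫⁻ ω : Conf k β,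
      ENNReal.ofReal (Real.exp (lam * (min (excess (Ico 0 1) r ω) n).toReal)) ∂poissonLaw k β ≤
        ENNReal.ofReal (Real.exp (C * Real.exp (-r)))) :
    ∫⁻ ω, min (excess (Ico 0 1) r ω) n ∂(P : Measure (Conf k β)) ≤
      ENNReal.ofReal ((c + C * Real.exp (-r)) / lam) := by
  have := isProbabilityMeasure_poissonLaw (k := k) (β := β) Fact.out
  have := isProbabilityMeasure_map_proj (P : Measure (Conf k β)) 1
  have := isProbabilityMeasure_map_proj (poissonLaw k β) 1
  have hme := measurable_excess (k := k) (β := β) (measurableSet_Ico (a := (0 : ℝ)) (b := 1)) r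
  let g : Conf k β → ℝ := fun ω => (min (excess (Ico 0 1) r ω) n).toReal
  have hg : Measurable g := by fun_prop
  have hmin : ∀ ω : Conf k β, min (excess (Ico 0 1) r ω) n ≠ ∞ := fun ω =>
    ((min_le_right _ _).trans_lt (ENNReal.natCast_lt_top n)).ne
  have hg0 : ∀ ω, 0 ≤ g ω := fun ω => ENNReal.toReal_nonneg
  have hgn : ∀ ω, g ω ≤ n := fun ω =>
    ENNReal.toReal_le_of_le_ofReal n.cast_nonneg (by simp)
  have hloc : ∀ ω, g (proj (box k 1) ω) = g ω := fun ω => by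
    simp only [g, box]
    rw [excess_proj]
    simpa using Ico_subset_Icc_self
  have hf : Measurable fun ω => lam * g ω := hg.const_mul lam
  have hfC : ∀ ω, |lam * g ω| ≤ lam * n := fun ω => by
    rw [abs_of_nonneg (mul_nonneg hlam.le (hg0 ω))]
    gcongr
    exact hgn ω
  have h1 := (ofReal_integral_sub_log_le_klDiv
    (μ := (P : Measure (Conf k β)).map (proj (box k 1)))
    (ν := (poissonLaw k β).map (proj (box k 1))) hf hfC).trans
    (show _ ≤ ENNReal.ofReal c by simpa [boxEntropy] using hP)
  rw [ENNReal.ofReal_le_ofReal_iff hc,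
    integral_map (measurable_proj_box 1).aemeasurable hf.aestronglyMeasurable,
    integral_map (measurable_proj_box 1).aemeasurable hf.exp.aestronglyMeasurable] at h1
  simp only [hloc] at h1
  have hint := integrable_exp_of_abs_le (μ := poissonLaw k β) hf hfC
  have h2 : ∫ ω, Real.exp (lam * g ω) ∂poissonLaw k β ≤ Real.exp (C * Real.exp (-r)) := by
    rw [← ENNReal.ofReal_le_ofReal_iff (Real.exp_nonneg _),
      ofReal_integral_eq_lintegral_ofReal hint (ae_of_all _ fun _ => (Real.exp_pos _).le)]
    exact hC
  have h3 := Real.log_le_log (integral_exp_pos hint) h2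
  rw [Real.log_exp] at h3
  rw [integral_const_mul] at h1
  have h4 : ∫ ω, g ω ∂(P : Measure (Conf k β)) ≤ (c + C * Real.exp (-r)) / lam := by
    rw [le_div_iff₀ hlam]
    linarith
  have hgint : Integrable g (P : Measure (Conf k β)) :=
    integrable_of_abs_le hg fun ω => by
      rw [abs_of_nonneg (hg0 ω)]
      exact hgn ω
  refine le_trans (le_of_eq ?_) (ENNReal.ofReal_le_ofReal h4)
  rw [ofReal_integral_eq_lintegral_ofReal hgint (ae_of_all _ hg0)]
  exact lintegral_congr fun ω => (ENNReal.ofReal_toReal (hmin ω)).symm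

theorem exists_lintegral_excess_le (k : ℕ) (β : ℝ) [Fact (0 < β)] {c ε : ℝ} (hc : 0 ≤ c)
    (hε : 0 < ε) : ∃ R : ℕ, ∀ r ≥ R, ∀ P : ProbabilityMeasure (Conf k β),
      boxEntropy P 1 ≤ ENNReal.ofReal c →
        ∫⁻ ω, excess (Ico 0 1) r ω ∂(P : Measure (Conf k β)) ≤ ENNReal.ofReal ε := by
  -- With `lam = (c + 1) / ε` the entropy bound becomes `ε` as soon as `C * exp (-r) ≤ 1`. That
  -- threshold depends on `P` only through `c`, which gives uniformity.
  obtain ⟨C, hC0, hC⟩ := exists_lintegral_exp_excess_le k β ((c + 1) / ε) (by positivity)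
  have hlim : Tendsto (fun r : ℕ => C * Real.exp (-r)) atTop (𝓝 (C * 0)) :=
    ((Real.tendsto_exp_neg_atTop_nhds_zero.comp tendsto_natCast_atTop_atTop)).const_mul C
  rw [mul_zero] at hlim
  obtain ⟨R, hR⟩ := eventually_atTop.1 (hlim.eventually_le_const zero_lt_one)
  refine ⟨R, fun r hr P hP => ?_⟩
  have hme := measurable_excess (k := k) (β := β) (measurableSet_Ico (a := (0 : ℝ)) (b := 1)) r
  have hsup : ∀ ω : Conf k β, excess (Ico 0 1) r ω = ⨆ n : ℕ, min (excess (Ico 0 1) r ω) n :=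
    fun ω => by
      rw [← inf_iSup_eq, ENNReal.iSup_natCast, inf_top_eq]
  rw [lintegral_congr hsup, lintegral_iSup (fun n => hme.min measurable_const)
    (fun m n hmn ω => by dsimp only; gcongr)]
  refine iSup_le fun n => ?_
  refine (lintegral_min_excess_le (lam := (c + 1) / ε) (by positivity) n hP hc
    (hC r n)).trans (ENNReal.ofReal_le_ofReal ?_)
  rw [div_le_iff₀ (by positivity), mul_div_cancel₀ _ hε.ne']
  linarith [hR r hr]

end

/-! ### Translation covariance of the energy -/

theorem measurePreserving_add_xVec (k : ℕ) (n : ℤ) :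
    MeasurePreserving (fun z : Cyl k => z + xVec k n) volume volume := by
  have h := (measurePreserving_add_right (volume : Measure ℝ) (n : ℝ)).prod
    (MeasurePreserving.id (volume : Measure (Fin k → UnitAddCircle)))
  have he : (fun z : Cyl k => z + xVec k n) = Prod.map (fun x => x + (n : ℝ)) id := by
    funext z
    simp [xVec, Prod.ext_iff]
  rw [he]
  exact h

theorem measurableEmbedding_add_xVec (k : ℕ) (n : ℤ) :
    MeasurableEmbedding fun z : Cyl k => z + xVec k n :=
  (MeasurableEquiv.addRight (xVec k n)).measurableEmbedding

theorem preimage_add_xVec_slab (n : ℤ) (I : Set ℝ) :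
    (fun z : Cyl k => z + xVec k n) ⁻¹' slab k I = slab k ((fun x => x + (n : ℝ)) ⁻¹' I) := rfl

theorem potential_shift (η : ℝ) (ω : Conf k β) (n : ℤ) (I : Set ℝ) (t : ℝ) (z : Cyl k) :
    potential η (shift n ω) (slab k ((fun x => x + (n : ℝ)) ⁻¹' I)) t z =
      potential η ω (slab k I) t (z + xVec k n) := by
  unfold potential
  rw [proj_shift]
  congr 1
  · change (∑ᶠ b ∈ translate (-xVec k n) '' (proj (slab k I) ω).bridges, _) = _
    rw [finsum_mem_image (translate_injective _).injOn]
    refine finsum_mem_congr rfl fun b _ => ?_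
    rw [translate_apply]
    congr 1
    abel
  · have h := (measurePreserving_add_xVec k n).setIntegral_preimage_emb
      (measurableEmbedding_add_xVec k n) (fun z' => green (z + xVec k n - z')) (slab k I)
    rw [← h, preimage_add_xVec_slab]
    simp only [add_sub_add_right_eq_sub]

theorem gradSq_add (V : Cyl k → ℝ) (w z : Cyl k) :
    gradSq (fun z => V (z + w)) z = gradSq V (z + w) := by
  unfold gradSq
  simp only [add_right_comm]

theorem fieldEnergy_shift (η : ℝ) (ω : Conf k β) (n : ℤ) (I J : Set ℝ) :
    fieldEnergy η (shift n ω) (slab k ((fun x => x + (n : ℝ)) ⁻¹' I))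
        (slab k ((fun x => x + (n : ℝ)) ⁻¹' J)) =
      fieldEnergy η ω (slab k I) (slab k J) := by
  unfold fieldEnergy
  congr 1
  have h : MeasurePreserving (Prod.map (fun z : Cyl k => z + xVec k n) (id : ℝ → ℝ))
      ((volume : Measure (Cyl k)).prod volume) ((volume : Measure (Cyl k)).prod volume) :=
    (measurePreserving_add_xVec k n).prod (MeasurePreserving.id _)
  have h' : MeasurableEmbedding (Prod.map (fun z : Cyl k => z + xVec k n) (id : ℝ → ℝ)) :=
    (measurableEmbedding_add_xVec k n).prodMap MeasurableEmbedding.id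
  have h1 := h.setLIntegral_comp_preimage_emb h'
    (fun p => gradSq (potential η ω (slab k I) p.2) p.1) (slab k J ×ˢ Icc 0 β)
  rw [Measure.volume_eq_prod, ← h1]
  refine lintegral_congr fun p => ?_
  have h2 : potential η (shift n ω) (slab k ((fun x => x + (n : ℝ)) ⁻¹' I)) p.2 =
      fun z => potential η ω (slab k I) p.2 (z + xVec k n) :=
    funext fun z => potential_shift η ω n I p.2 z
  rw [h2, gradSq_add]
  rfl

theorem neut_shift {ω : Conf k β} {p q : ℤ} (n : ℤ) (h : ω ∈ Neut (slab k (Icc (p : ℝ) q))) :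
    shift n ω ∈ Neut (slab k (Icc ((p - n : ℤ) : ℝ) ((q - n : ℤ) : ℝ))) := by
  have hI : Icc ((p - n : ℤ) : ℝ) ((q - n : ℤ) : ℝ) =
      (fun x => x + (n : ℝ)) ⁻¹' Icc (p : ℝ) q := by
    ext x
    simp only [mem_Icc, mem_preimage]
    push_cast
    constructor <;> rintro ⟨h, h'⟩ <;> constructor <;> linarith
  rw [hI]
  refine ⟨fun b hb => ?_, ?_⟩
  · have := h.1 _ (mem_shift.1 hb)
    exact this
  · rw [← preimage_add_xVec_slab, (measurePreserving_add_xVec k n).measure_preimage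
      (measurableSet_slab measurableSet_Icc).nullMeasurableSet, ← h.2]
    congr 1
    exact (translate_injective _).encard_image _

theorem theta_shift {ω : Conf k β} {l r : ℝ} (n : ℤ) (h : ω ∈ Theta (l + n) (r + n)) :
    shift n ω ∈ Theta l r := by
  intro b hb h0 t ht
  refine h _ (mem_shift.1 hb) ?_ t ?_
  · intro h1
    refine h0 ?_
    simp only [translate_apply, slab, mem_ofPred_eq, xVec, mem_Icc, Prod.fst_add] at h1 ⊢
    constructor <;> linarith [h1.1, h1.2]
  · simp only [translate_apply, slab, mem_ofPred_eq, xVec, mem_Icc, Prod.fst_add, eroded,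
      add_sub_add_right_eq_sub] at ht ⊢
    constructor <;> linarith [ht.1, ht.2]

/-- Shifting a competitor for the translated window gives a competitor of the same energy; as `n` is
an integer, the ends of the neutral box stay integers. -/
theorem minEnergy_shift_le (η l r : ℝ) (n : ℤ) (ω : Conf k β) :
    minEnergy η l r (shift n ω) ≤ minEnergy η (l + n) (r + n) ω := by
  have hI : ∀ a b : ℝ, (fun x => x + (n : ℝ)) ⁻¹' Icc (a + n) (b + n) = Icc a b := fun a b => by
    ext x
    simp
  unfold minEnergy
  refine le_iInf fun p => le_iInf fun q => le_iInf fun ω' => le_iInf fun h1 => le_iInf fun h2 =>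
    le_iInf fun h3 => le_iInf fun h4 => ?_
  have hpq : Icc ((p - n : ℤ) : ℝ) ((q - n : ℤ) : ℝ) =
      (fun x => x + (n : ℝ)) ⁻¹' Icc (p : ℝ) q := by
    rw [← hI]
    push_cast
    simp
  refine iInf_le_of_le (p - n) (iInf_le_of_le (q - n) (iInf_le_of_le (shift n ω')
    (iInf_le_of_le ?_ (iInf_le_of_le (neut_shift n h2) (iInf_le_of_le (theta_shift n h3)
      (iInf_le_of_le ?_ ?_))))))
  · rw [hpq, ← hI l r]
    exact fun z hz => h1 (a := z + xVec k n) hz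
  · rw [← hI l r, proj_shift, proj_shift, h4]
  · rw [hpq, ← hI l r, fieldEnergy_shift]

/-! ### Superadditivity of the minimal energy -/

theorem eroded_subset {l r : ℝ} (h : l ≤ r) : eroded l r ⊆ Icc l r := by
  have h1 : (0 : ℝ) ≤ ⌈(r - l) ^ (7 / 8 : ℝ)⌉ := by
    exact_mod_cast Int.ceil_nonneg (Real.rpow_nonneg (sub_nonneg.2 h) _)
  exact Icc_subset_Icc (by linarith) (by linarith)

/-- A competitor for the long window is one for the block, with the same neutral box. Only
membership in `Theta l r` needs an argument, and it is the reason why blocks must avoid the boundary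
layer. -/
theorem minEnergy_le_fieldEnergy {η l r L : ℝ} {ω ω' : Conf k β} {p q : ℤ} (hlr : l ≤ r)
    (h0 : Icc l r ⊆ Icc 0 L) (hin : Icc l r ⊆ eroded 0 L)
    (hgood : ∀ b ∈ ω.bridges, b 0 ∉ slab k (Icc l r) → ∀ t, b t ∉ slab k (eroded l r))
    (h1 : slab k (Icc 0 L) ⊆ slab k (Icc (p : ℝ) q)) (h2 : ω' ∈ Neut (slab k (Icc (p : ℝ) q)))
    (h3 : ω' ∈ Theta 0 L) (h4 : proj (slab k (Icc 0 L)) ω' = proj (slab k (Icc 0 L)) ω) :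
    minEnergy η l r ω ≤ fieldEnergy η ω' (slab k (Icc p q)) (slab k (Icc l r)) := by
  refine iInf_le_of_le p (iInf_le_of_le q (iInf_le_of_le ω' (iInf_le_of_le ?_
    (iInf_le_of_le h2 (iInf_le_of_le ?_ (iInf_le_of_le ?_ le_rfl))))))
  · exact fun z hz => h1 (h0 hz)
  · intro b hb hb0 t
    -- Bridges of `ω'` starting in the long window belong to `ω`, where `hgood` controls them; the
    -- others are kept out of the block by `Theta 0 L`.
    by_cases hbL : b 0 ∈ slab k (Icc 0 L)
    · have hb' : b ∈ (proj (slab k (Icc 0 L)) ω').bridges := ⟨hb, hbL⟩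
      rw [h4] at hb'
      exact hgood b hb'.1 hb0 t
    · exact fun ht => h3 b hb hbL t (hin (eroded_subset hlr ht))
  · rw [← proj_proj_slab h0, h4, proj_proj_slab h0]

theorem slab_Icc_prod_ae_eq (k : ℕ) (a b β : ℝ) :
    (slab k (Icc a b) ×ˢ Icc 0 β : Set (Cyl k × ℝ)) =ᵐ[volume]
      (slab k (Ico a b) ×ˢ Icc 0 β : Set (Cyl k × ℝ)) := by
  have h : ∀ I : Set ℝ, slab k I = I ×ˢ univ := fun I => by ext; simp [slab]
  rw [h, h, Measure.volume_eq_prod]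
  refine Measure.set_prod_ae_eq ?_ ae_eq_rfl
  rw [Measure.volume_eq_prod]
  exact Measure.set_prod_ae_eq Ico_ae_eq_Icc.symm ae_eq_rfl

/-- The closed blocks overlap only in cross-sections of measure zero, so they may be replaced by
disjoint half-open ones. -/
theorem sum_fieldEnergy_le (η : ℝ) (ω : Conf k β) (Λ : Set (Cyl k)) {N L : ℕ} {I : Finset ℕ}
    (hI : ∀ i ∈ I, (i + 1) * N ≤ L) :
    ∑ i ∈ I, fieldEnergy η ω Λ (slab k (Icc ((i * N : ℕ) : ℝ) ((i * N : ℕ) + N))) ≤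
      fieldEnergy η ω Λ (slab k (Icc 0 (L : ℝ))) := by
  unfold fieldEnergy
  rw [← Finset.mul_sum]
  gcongr
  simp_rw [setLIntegral_congr (slab_Icc_prod_ae_eq k _ _ β)]
  rw [← lintegral_biUnion_finset]
  · refine (lintegral_mono_set ?_).trans_eq (setLIntegral_congr (slab_Icc_prod_ae_eq k _ _ β))
    refine iUnion₂_subset fun i hi => prod_mono_left fun z hz => ?_
    have h1 : ((i * N : ℕ) : ℝ) + N ≤ L := by
      have := hI i hi
      rw [add_mul, one_mul] at this
      exact_mod_cast this
    exact ⟨(Nat.cast_nonneg _).trans hz.1, (hz.2.trans_le h1).le⟩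
  · intro i _ j _ hij
    rw [Function.onFun, disjoint_left]
    rintro ⟨z, t⟩ ⟨⟨h1, h2⟩, -⟩ ⟨⟨h3, h4⟩, -⟩
    dsimp only at h1 h2 h3 h4
    have h5 : i * N < j * N + N := by exact_mod_cast h1.trans_lt h4
    have h6 : j * N < i * N + N := by exact_mod_cast h3.trans_lt h2
    rw [← Nat.succ_mul] at h5 h6
    have h7 := Nat.lt_of_mul_lt_mul_right h5
    have h8 := Nat.lt_of_mul_lt_mul_right h6
    omega
  · exact fun i _ => (measurableSet_slab measurableSet_Ico).prod measurableSet_Icc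

/-- The width `⌈N^{7/8}⌉` of the boundary layer of an interval of length `N`. -/
noncomputable def layer (N : ℕ) : ℕ := ⌈(N : ℝ) ^ (7 / 8 : ℝ)⌉₊

theorem eroded_eq (a : ℝ) (N : ℕ) : eroded a (a + N) = Icc (a + layer N) (a + N - layer N) := by
  rw [eroded, layer, natCast_ceil_eq_intCast_ceil (by positivity), add_sub_cancel_left]

/-- One competitor for the long window serves all blocks at once, so taking the infimum at the end
costs nothing. -/
theorem sum_minEnergy_le (η : ℝ) {N L : ℕ} {I : Finset ℕ} {ω : Conf k β}
    (hI : ∀ i ∈ I, layer L ≤ i * N ∧ (i + 1) * N + layer L ≤ L)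
    (hgood : ∀ i ∈ I, ∀ b ∈ ω.bridges, b 0 ∉ slab k (Icc ((i * N : ℕ) : ℝ) ((i * N : ℕ) + N)) →
      ∀ t, b t ∉ slab k (eroded ((i * N : ℕ) : ℝ) ((i * N : ℕ) + N))) :
    ∑ i ∈ I, minEnergy η ((i * N : ℕ) : ℝ) ((i * N : ℕ) + N) ω ≤ minEnergy η 0 L ω := by
  conv_rhs => unfold minEnergy
  refine le_iInf fun p => le_iInf fun q => le_iInf fun ω' => le_iInf fun h1 => le_iInf fun h2 =>
    le_iInf fun h3 => le_iInf fun h4 => ?_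
  refine le_trans (Finset.sum_le_sum fun i hi => ?_)
    (sum_fieldEnergy_le η ω' (slab k (Icc (p : ℝ) q)) (I := I) (N := N) fun i hi => by
      have := (hI i hi).2
      omega)
  have hl : ((layer L : ℕ) : ℝ) ≤ (i * N : ℕ) := by exact_mod_cast (hI i hi).1
  have hr : ((i * N : ℕ) : ℝ) + N + layer L ≤ L := by
    have := (hI i hi).2
    rw [add_mul, one_mul] at this
    exact_mod_cast this
  have hl0 : (0 : ℝ) ≤ (layer L : ℕ) := Nat.cast_nonneg _
  refine minEnergy_le_fieldEnergy (by linarith [N.cast_nonneg (α := ℝ)])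
    (Icc_subset_Icc (by linarith) (by linarith)) ?_ (hgood i hi) h1 h2 h3 h4
  have := eroded_eq 0 L
  rw [zero_add] at this
  rw [this]
  exact Icc_subset_Icc (by linarith) (by linarith)

section

/-! ### Truncated energy densities and blocks -/

/-- The truncated energy density of the box of length `N`. -/
noncomputable def density (η : ℝ) (M : ℝ≥0) (N : ℕ) (ω : Conf k β) : ℝ≥0∞ :=
  min (minEnergy η 0 N ω / N) M

theorem mul_density {N : ℕ} (hN : 0 < N) (η : ℝ) (M : ℝ≥0) (ω : Conf k β) :
    N * density η M N ω = min (minEnergy η 0 N ω) (N * M) := by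
  have h : Monotone fun x : ℝ≥0∞ => N * x := fun _ _ h => by dsimp only; gcongr
  have h1 := h.map_min (a := minEnergy η 0 N ω / N) (b := (M : ℝ≥0∞))
  rw [density, h1, ENNReal.mul_div_cancel (by exact_mod_cast hN.ne') (ENNReal.natCast_ne_top N)]

/-- Lower integrals are superadditive without any measurability. This is the direction needed for
`density`, whose measurability is not established. -/
theorem sum_lintegral_le {α ι : Type*} [MeasurableSpace α] (μ : Measure α) (s : Finset ι)
    (f : ι → α → ℝ≥0∞) : ∑ i ∈ s, ∫⁻ x, f i x ∂μ ≤ ∫⁻ x, ∑ i ∈ s, f i x ∂μ := by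
  classical
  induction s using Finset.induction_on with
  | empty => simp
  | insert i s hi ih =>
    simp only [Finset.sum_insert hi]
    exact (add_le_add_right ih _).trans (le_lintegral_add _ _)

theorem boxEnergy_eq (η : ℝ) (P : ProbabilityMeasure (Conf k β)) (M : ℝ≥0) (N : ℕ) :
    boxEnergy η P M N = ∫⁻ ω, density η M N ω ∂(P : Measure (Conf k β)).map (proj (box k N)) := rfl

theorem IsStationary.map_proj_shift {P : ProbabilityMeasure (Conf k β)} (hP : IsStationary P)
    {n : ℤ} {N L : ℕ} (h0 : 0 ≤ n) (h : n + N ≤ L) :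
    ((P : Measure (Conf k β)).map (proj (box k L))).map (fun ω => proj (box k N) (shift n ω)) =
      (P : Measure (Conf k β)).map (proj (box k N)) := by
  have hm : Measurable fun ω : Conf k β => proj (box k N) (shift n ω) :=
    (measurable_proj_box N).comp (measurable_shift n)
  rw [Measure.map_map hm (measurable_proj_box L)]
  conv_rhs => rw [← hP n, Measure.map_map (measurable_proj_box N) (measurable_shift n)]
  congr 1
  exact funext fun ω => proj_box_shift_proj_box h0 h ω

/-- The law in the small box is the image of the law in the long box, and for an arbitrary integrand
the lower integral can only grow when pulled back. -/
theorem IsStationary.boxEnergy_le {P : ProbabilityMeasure (Conf k β)} (hP : IsStationary P)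
    (η : ℝ) (M : ℝ≥0) {n : ℤ} {N L : ℕ} (h0 : 0 ≤ n) (h : n + N ≤ L) :
    boxEnergy η P M N ≤
      ∫⁻ ω, density η M N (shift n ω) ∂(P : Measure (Conf k β)).map (proj (box k L)) := by
  rw [boxEnergy_eq, ← hP.map_proj_shift h0 h]
  refine (lintegral_map_le _ _).trans (le_of_eq ?_)
  refine lintegral_congr fun ω => ?_
  simp only [density, box, minEnergy_proj]

/-- The exponent `7 / 8` matters only through lying in `(0, 1)`: below `1` the layer is a negligible
part of the box, and above `0` it grows without bound, as `tendsto_layer` records. -/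
theorem tendsto_layer_div : Tendsto (fun L : ℕ => (layer L : ℝ) / L) atTop (𝓝 0) := by
  have h1 : Tendsto (fun L : ℕ => (L : ℝ) ^ (-(1 / 8) : ℝ) + 1 / L) atTop (𝓝 (0 + 0)) :=
    ((tendsto_rpow_neg_atTop (by norm_num)).comp tendsto_natCast_atTop_atTop).add
      (tendsto_const_div_atTop_nhds_zero_nat 1)
  rw [add_zero] at h1
  refine squeeze_zero' (Eventually.of_forall fun L => by positivity) ?_ h1
  filter_upwards [eventually_gt_atTop 0] with L hL
  have hL' : (0 : ℝ) < L := by exact_mod_cast hL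
  have h2 : (layer L : ℝ) ≤ (L : ℝ) ^ (7 / 8 : ℝ) + 1 :=
    (Nat.ceil_lt_add_one (by positivity)).le
  rw [show (-(1 / 8) : ℝ) = 7 / 8 - 1 by norm_num, Real.rpow_sub_one hL'.ne', ← add_div]
  gcongr

theorem tendsto_layer : Tendsto layer atTop atTop :=
  tendsto_nat_ceil_atTop.comp
    ((tendsto_rpow_atTop (by norm_num)).comp tendsto_natCast_atTop_atTop)

/-- Almost all of a long box can be filled with blocks that avoid its boundary layer. -/
theorem exists_blocks {N : ℕ} (hN : 0 < N) (L : ℕ) :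
    ∃ I : Finset ℕ, (∀ i ∈ I, layer L ≤ i * N ∧ (i + 1) * N + layer L ≤ L) ∧ I.card * N ≤ L ∧
      (L : ℝ) - (2 * layer L + 2 * N) ≤ (I.card * N : ℕ) := by
  set l := layer L
  -- These blocks lie between `l` and `L - l`; rounding loses at most one block length at the upper
  -- end and one at the lower.
  refine ⟨Finset.Ico (l / N + 1) ((L - l) / N), fun i hi => ?_, ?_, ?_⟩
  · rw [Finset.mem_Ico] at hi
    constructor
    · have h1 := Nat.lt_div_mul_add (a := l) hN
      calc l ≤ (l / N + 1) * N := by rw [add_mul, one_mul]; exact h1.le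
        _ ≤ i * N := Nat.mul_le_mul_right N hi.1
    · have h1 : (i + 1) * N ≤ L - l :=
        (Nat.mul_le_mul_right N hi.2).trans (Nat.div_mul_le_self _ _)
      -- Positivity excludes the case in which the natural subtraction `L - l` is truncated to `0`.
      have h2 : 0 < (i + 1) * N := by positivity
      omega
  · rw [Nat.card_Ico]
    calc ((L - l) / N - (l / N + 1)) * N ≤ (L - l) / N * N :=
          Nat.mul_le_mul_right N (Nat.sub_le _ _)
      _ ≤ L - l := Nat.div_mul_le_self _ _
      _ ≤ L := Nat.sub_le _ _
  · rw [Nat.card_Ico, Nat.sub_mul]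
    have h1 := Nat.lt_div_mul_add (a := L - l) hN
    have h2 := Nat.div_mul_le_self l N
    have h3 : L ≤ ((L - l) / N * N - (l / N + 1) * N) + (2 * l + 2 * N) := by
      rw [add_mul, one_mul]
      omega
    have : (L : ℝ) ≤ (((L - l) / N * N - (l / N + 1) * N : ℕ) : ℝ) + (2 * l + 2 * N) := by
      exact_mod_cast h3
    linarith

theorem one_le_count_of_mem {A : Set (Loop k β)} {ω : Conf k β} {b : Loop k β}
    (hb : b ∈ ω.bridges) (hA : b ∈ A) : (1 : ℝ≥0∞) ≤ count A ω := by
  have h : (1 : ℕ∞) ≤ count A ω := one_le_encard_iff_nonempty.2 ⟨b, hb, hA⟩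
  exact_mod_cast ENat.toENNReal_le.2 h

theorem IsStationary.lintegral_shift {P : ProbabilityMeasure (Conf k β)} (hP : IsStationary P)
    (n : ℤ) {f : Conf k β → ℝ≥0∞} (hf : Measurable f) :
    ∫⁻ ω, f (shift n ω) ∂(P : Measure (Conf k β)) = ∫⁻ ω, f ω ∂(P : Measure (Conf k β)) := by
  conv_rhs => rw [← hP n]
  rw [lintegral_map hf (measurable_shift n)]

/-! ### Bridges that stray into the interior of a block -/

variable [Fact (0 < β)]

/-- Counts the bridges starting outside `[a, a + N] × D` that reach at least as far as the eroded
block. -/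
noncomputable def stray (a : ℤ) (N : ℕ) (ω : Conf k β) : ℝ≥0∞ :=
  ∑' m : ℕ, ((count (farLoops k β (Ico ((a + N + m : ℤ) : ℝ) ((a + N + m : ℤ) + 1)) (m + layer N))
      ω : ℝ≥0∞) +
    (count (farLoops k β (Ico ((a - 1 - m : ℤ) : ℝ) ((a - 1 - m : ℤ) + 1)) (m + layer N))
      ω : ℝ≥0∞))

theorem measurable_stray (a : ℤ) (N : ℕ) : Measurable (stray a N : Conf k β → ℝ≥0∞) :=
  Measurable.tsum fun _ => (measurable_count_toENNReal (measurableSet_farLoops measurableSet_Ico _)).add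
    (measurable_count_toENNReal (measurableSet_farLoops measurableSet_Ico _))

/-- A bridge starting in the `m`-th unit cell to the right or left of the block has distance at
least `m` from it, and must cross the boundary layer as well to reach the eroded block. -/
theorem one_le_stray {a : ℤ} {N : ℕ} {ω : Conf k β} {b : Loop k β} (hb : b ∈ ω.bridges)
    (h0 : b 0 ∉ slab k (Icc (a : ℝ) (a + N))) {t : AddCircle β}
    (ht : b t ∈ slab k (eroded (a : ℝ) (a + N))) : 1 ≤ stray a N ω := by
  rw [eroded_eq] at ht
  have ht' : (a : ℝ) + layer N ≤ (b t).1 ∧ (b t).1 ≤ a + N - layer N := ht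
  have hdisp : |(b t).1 - (b 0).1| ≤ ‖displacement b‖ :=
    ContinuousMap.norm_coe_le_norm (displacement b) t
  have hfl := Int.floor_le (b 0).1
  have hfl' := Int.lt_floor_add_one (b 0).1
  rcases lt_or_ge (a + N : ℝ) (b 0).1 with h | h
  · have h1 : a + N ≤ ⌊(b 0).1⌋ := Int.le_floor.2 (by push_cast; exact h.le)
    obtain ⟨m, hm⟩ := Int.eq_ofNat_of_zero_le (sub_nonneg.2 h1)
    have hm' : ⌊(b 0).1⌋ = a + N + m := by linarith
    have hmr : ((a + N + m : ℤ) : ℝ) ≤ (b 0).1 := hm' ▸ hfl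
    refine le_trans ?_ (ENNReal.le_tsum m)
    refine le_trans (one_le_count_of_mem hb ?_) le_self_add
    refine ⟨⟨hmr, hm' ▸ hfl'⟩, le_trans ?_ ((neg_le_abs _).trans hdisp)⟩
    push_cast at hmr ⊢
    linarith
  · have h2 : (b 0).1 < a := by
      by_contra! hcon
      exact h0 ⟨hcon, h⟩
    have h1 : ⌊(b 0).1⌋ ≤ a - 1 := by
      have := Int.floor_lt.2 h2
      omega
    obtain ⟨m, hm⟩ := Int.eq_ofNat_of_zero_le (sub_nonneg.2 h1)
    have hm' : ⌊(b 0).1⌋ = a - 1 - m := by linarith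
    have hmr : (b 0).1 < ((a - 1 - m : ℤ) : ℝ) + 1 := hm' ▸ hfl'
    refine le_trans ?_ (ENNReal.le_tsum m)
    refine le_trans (one_le_count_of_mem hb ?_) le_add_self
    refine ⟨⟨hm' ▸ hfl, hmr⟩, le_trans ?_ ((le_abs_self _).trans hdisp)⟩
    push_cast at hmr ⊢
    linarith

theorem IsStationary.lintegral_count {P : ProbabilityMeasure (Conf k β)} (hP : IsStationary P)
    (n : ℤ) (r : ℕ) :
    ∫⁻ ω, (count (farLoops k β (Ico (n : ℝ) (n + 1)) r) ω : ℝ≥0∞) ∂(P : Measure (Conf k β)) =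
      ∫⁻ ω, (count (farLoops k β (Ico 0 1) r) ω : ℝ≥0∞) ∂(P : Measure (Conf k β)) := by
  have hI : (fun x => x + (n : ℝ)) ⁻¹' Ico (n : ℝ) (n + 1) = Ico 0 1 := by
    ext x
    simp only [mem_Ico, mem_preimage]
    constructor <;> rintro ⟨h, h'⟩ <;> constructor <;> linarith
  have h := hP.lintegral_shift n (measurable_count_toENNReal
    (measurableSet_farLoops (k := k) (β := β) (measurableSet_Ico (a := (0 : ℝ)) (b := 1)) r))
  rw [← h]
  refine lintegral_congr fun ω => ?_
  rw [← hI, count_farLoops_shift]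

/-- By stationarity every cell may be moved to `[0, 1)`. Summing over the distance `m` then gives
the mean excess, once for each side of the block. -/
theorem IsStationary.lintegral_stray {P : ProbabilityMeasure (Conf k β)} (hP : IsStationary P)
    (a : ℤ) (N : ℕ) :
    ∫⁻ ω, stray a N ω ∂(P : Measure (Conf k β)) =
      2 * ∫⁻ ω, excess (Ico 0 1) (layer N) ω ∂(P : Measure (Conf k β)) := by
  have hm : ∀ (n : ℤ) r, Measurable fun ω : Conf k β =>
      (count (farLoops k β (Ico (n : ℝ) (n + 1)) r) ω : ℝ≥0∞) := fun n r =>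
    measurable_count_toENNReal (measurableSet_farLoops measurableSet_Ico _)
  unfold stray excess
  rw [lintegral_tsum fun m => (by exact ((hm _ _).add (hm _ _)).aemeasurable),
    lintegral_tsum fun m => (measurable_count_toENNReal
      (measurableSet_farLoops measurableSet_Ico _)).aemeasurable, ← ENNReal.tsum_mul_left]
  refine tsum_congr fun m => ?_
  rw [lintegral_add_left (hm _ _), hP.lintegral_count, hP.lintegral_count, two_mul]

/-! ### Approximate superadditivity of the truncated energy -/

/-- Blocks without stray bridges satisfy the exact superadditivity, and their total truncation level
`J.card * N * M` is at most `L * M`. Any other block has truncated energy at most `N * M`, which is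
paid by its stray count being at least `1`. -/
theorem sum_density_le (η : ℝ) (M : ℝ≥0) {N L : ℕ} (hN : 0 < N) (hL : 0 < L) {I : Finset ℕ}
    (hI : ∀ i ∈ I, layer L ≤ i * N ∧ (i + 1) * N + layer L ≤ L) (hcard : I.card * N ≤ L)
    (ω : Conf k β) :
    ∑ i ∈ I, N * density η M N (shift ((i * N : ℕ) : ℤ) ω) ≤
      L * density η M L ω + N * M * ∑ i ∈ I, stray ((i * N : ℕ) : ℤ) N ω := by
  classical
  let E : ℕ → ℝ≥0∞ := fun i => minEnergy η ((i * N : ℕ) : ℝ) ((i * N : ℕ) + N) ω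
  set J := I.filter fun i => ¬ 1 ≤ stray ((i * N : ℕ) : ℤ) N ω with hJ
  have hE : ∀ i, N * density η M N (shift ((i * N : ℕ) : ℤ) ω) ≤ min (E i) (N * M) := fun i => by
    rw [mul_density hN]
    gcongr
    refine (minEnergy_shift_le η 0 N _ ω).trans (le_of_eq ?_)
    simp only [E, Int.cast_natCast, zero_add]
    rw [add_comm]
  have h1 : ∀ i ∈ I, N * density η M N (shift ((i * N : ℕ) : ℤ) ω) ≤
      (if ¬ 1 ≤ stray ((i * N : ℕ) : ℤ) N ω then min (E i) (N * M) else 0) +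
        N * M * stray ((i * N : ℕ) : ℤ) N ω := by
    intro i _
    refine (hE i).trans ?_
    split_ifs with h
    · rw [zero_add]
      calc min (E i) (N * M) ≤ N * M * 1 := by rw [mul_one]; exact min_le_right _ _
        _ ≤ _ := by gcongr
    · exact le_self_add
  refine (Finset.sum_le_sum h1).trans ?_
  rw [Finset.sum_add_distrib, ← Finset.mul_sum, ← Finset.sum_filter, mul_density hL]
  gcongr
  refine le_min ?_ ?_
  · refine (Finset.sum_le_sum fun i _ => min_le_left _ _).trans ?_
    refine sum_minEnergy_le η (fun i hi => hI i (Finset.mem_filter.1 hi).1) ?_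
    intro i hi b hb h0 t ht
    refine (Finset.mem_filter.1 hi).2 (one_le_stray hb (t := t) ?_ ?_)
    · simpa using h0
    · simpa using ht
  · refine (Finset.sum_le_sum fun i _ => min_le_right _ _).trans ?_
    rw [Finset.sum_const, nsmul_eq_mul, ← mul_assoc]
    gcongr
    have h2 : J.card * N ≤ L :=
      (Nat.mul_le_mul_right N (Finset.card_filter_le _ _)).trans hcard
    exact_mod_cast h2

/-- The pointwise estimate is integrated against the law in the box of length `L`; restriction to
the box only removes stray bridges. The integral of the sum splits because the stray term is
measurable. -/
theorem IsStationary.card_mul_boxEnergy_le {P : ProbabilityMeasure (Conf k β)}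
    (hP : IsStationary P) (η : ℝ) (M : ℝ≥0) {N L : ℕ} (hN : 0 < N) (hL : 0 < L) {I : Finset ℕ}
    (hI : ∀ i ∈ I, layer L ≤ i * N ∧ (i + 1) * N + layer L ≤ L) (hcard : I.card * N ≤ L) :
    (I.card * N : ℕ) * boxEnergy η P M N ≤ L * boxEnergy η P M L +
      (I.card * N : ℕ) *
        (2 * M * ∫⁻ ω, excess (Ico 0 1) (layer N) ω ∂(P : Measure (Conf k β))) := by
  set Q := (P : Measure (Conf k β)).map (proj (box k L)) with hQ
  have hstray : ∀ a, ∫⁻ ω, stray a N ω ∂Q ≤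
      2 * ∫⁻ ω, excess (Ico 0 1) (layer N) ω ∂(P : Measure (Conf k β)) := fun a => by
    rw [hQ, lintegral_map (measurable_stray a N) (measurable_proj_box L), ← hP.lintegral_stray a N]
    refine lintegral_mono fun ω => ENNReal.tsum_le_tsum fun m => ?_
    gcongr <;> exact count_proj_le _ _ _
  calc ((I.card * N : ℕ) : ℝ≥0∞) * boxEnergy η P M N = ∑ i ∈ I, N * boxEnergy η P M N := by
        rw [Finset.sum_const, nsmul_eq_mul]
        push_cast
        ring
    _ ≤ ∑ i ∈ I, ∫⁻ ω, N * density η M N (shift ((i * N : ℕ) : ℤ) ω) ∂Q := by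
        refine Finset.sum_le_sum fun i hi => ?_
        rw [lintegral_const_mul' _ _ (ENNReal.natCast_ne_top N)]
        gcongr
        refine hP.boxEnergy_le η M (by positivity) ?_
        have := (hI i hi).2
        rw [add_mul, one_mul] at this
        exact_mod_cast (le_self_add.trans this)
    _ ≤ ∫⁻ ω, ∑ i ∈ I, N * density η M N (shift ((i * N : ℕ) : ℤ) ω) ∂Q := sum_lintegral_le _ _ _
    _ ≤ ∫⁻ ω, (L * density η M L ω + N * M * ∑ i ∈ I, stray ((i * N : ℕ) : ℤ) N ω) ∂Q :=
        lintegral_mono fun ω => sum_density_le η M hN hL hI hcard ω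
    _ = L * boxEnergy η P M L + N * M * ∑ i ∈ I, ∫⁻ ω, stray ((i * N : ℕ) : ℤ) N ω ∂Q := by
        have hm := Finset.measurable_fun_sum I fun i _ =>
          measurable_stray (k := k) (β := β) ((i * N : ℕ) : ℤ) N
        rw [lintegral_add_right _ (hm.const_mul _), lintegral_const_mul' _ _
          (ENNReal.natCast_ne_top L), lintegral_const_mul _ hm,
          lintegral_finsetSum _ fun i _ => measurable_stray _ _, boxEnergy_eq]
    _ ≤ L * boxEnergy η P M L + N * M * ∑ i ∈ I,
        2 * ∫⁻ ω, excess (Ico 0 1) (layer N) ω ∂(P : Measure (Conf k β)) := by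
        gcongr with i _
        exact hstray _
    _ = _ := by
        rw [Finset.sum_const, nsmul_eq_mul]
        push_cast
        ring

theorem IsStationary.boxEnergy_le_liminf {P : ProbabilityMeasure (Conf k β)}
    (hP : IsStationary P) (η : ℝ) (M : ℝ≥0) {N : ℕ} (hN : 0 < N) :
    boxEnergy η P M N ≤ liminf (boxEnergy η P M) atTop +
      2 * M * ∫⁻ ω, excess (Ico 0 1) (layer N) ω ∂(P : Measure (Conf k β)) := by
  choose I hI hcard hlow using exists_blocks hN
  have hb : Tendsto (fun L : ℕ => (2 * layer L + 2 * N : ℝ) / L) atTop (𝓝 0) := by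
    have := (tendsto_layer_div.const_mul 2).add (tendsto_const_div_atTop_nhds_zero_nat (2 * N : ℝ))
    rw [mul_zero, add_zero] at this
    refine this.congr fun L => ?_
    ring
  have hκ := tendsto_ofReal_div_of_le (a := fun L => (((I L).card * N : ℕ) : ℝ))
    (b := fun L => 2 * layer L + 2 * N) (fun L => by exact_mod_cast hcard L) hlow hb
  refine le_liminf_add_of_mul_le hκ ?_
  filter_upwards [eventually_gt_atTop 0] with L hL
  have hL' : (0 : ℝ) < L := by exact_mod_cast hL
  have hL0 : (L : ℝ≥0∞) ≠ 0 := by exact_mod_cast hL.ne'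
  rw [ENNReal.ofReal_div_of_pos hL', ENNReal.ofReal_natCast, ENNReal.ofReal_natCast]
  have h := hP.card_mul_boxEnergy_le η M hN hL (hI L) (hcard L)
  set X := 2 * M * ∫⁻ ω, excess (Ico 0 1) (layer N) ω ∂(P : Measure (Conf k β))
  have hle : (((I L).card * N : ℕ) : ℝ≥0∞) ≤ L := by exact_mod_cast hcard L
  rw [div_eq_mul_inv, mul_right_comm, ← div_eq_mul_inv]
  refine ENNReal.div_le_of_le_mul (h.trans ?_)
  rw [add_mul, mul_comm (L : ℝ≥0∞), mul_comm X]
  gcongr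

end

section

/-! ### Stationarity is a closed condition -/

theorem isBoundedLocal_comp_proj_shift {f : Conf k β → ℝ} (hf : Measurable f) {C : ℝ}
    (hC : ∀ ω, |f ω| ≤ C) (a b : ℝ) (n : ℤ) :
    IsBoundedLocal fun ω => f (proj (slab k (Icc a b)) (shift n ω)) := by
  have h : ∀ ω : Conf k β, proj (slab k (Icc a b)) (shift n ω) =
      shift n (proj (slab k (Icc (a + n) (b + n))) ω) := fun ω => by
    rw [← proj_shift]
    congr 2
    ext x
    simp
  simp only [h]
  exact isBoundedLocal_comp_proj (f := fun ω => f (shift n ω)) (hf.comp (measurable_shift n))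
    (fun ω => hC _) _ _

/-- The events that are determined by a bounded window. -/
def localEvents (k : ℕ) (β : ℝ) : Set (Set (Conf k β)) :=
  {B | ∃ (N : ℕ) (A : Set (Conf k β)), MeasurableSet A ∧
    B = proj (slab k (Icc (-N : ℝ) N)) ⁻¹' A}

theorem measurable_proj_window (N : ℕ) :
    Measurable (proj (slab k (Icc (-N : ℝ) N)) : Conf k β → Conf k β) :=
  measurable_proj (measurableSet_slab measurableSet_Icc)

theorem isPiSystem_localEvents : IsPiSystem (localEvents k β) := by
  have hsub : ∀ {M N : ℕ}, M ≤ N → Icc (-M : ℝ) M ⊆ Icc (-N : ℝ) N := fun {M N} h => by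
    have : (M : ℝ) ≤ N := by exact_mod_cast h
    exact Icc_subset_Icc (by linarith) this
  rintro _ ⟨M, A, hA, rfl⟩ _ ⟨N, B, hB, rfl⟩ -
  refine ⟨max M N, _, (measurable_proj_window M hA).inter (measurable_proj_window N hB), ?_⟩
  ext ω
  simp only [mem_inter_iff, mem_preimage]
  rw [proj_proj_slab (hsub (le_max_left M N)), proj_proj_slab (hsub (le_max_right M N))]

/-- Any finite set of bridges starts in a bounded window. Comparing with finite subsets also covers
an infinite count. -/
theorem count_eq_iSup (A : Set (Loop k β)) (ω : Conf k β) :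
    count A ω = ⨆ N : ℕ, count A (proj (slab k (Icc (-N : ℝ) N)) ω) := by
  refine le_antisymm ?_ (iSup_le fun N => count_proj_le _ _ _)
  refine ENat.forall_natCast_le_iff_le.1 fun n hn => ?_
  obtain ⟨t, ht, htn⟩ := exists_subset_encard_eq hn
  have htf : t.Finite := finite_of_encard_eq_coe htn
  obtain ⟨N, hN⟩ : ∃ N : ℕ, ∀ b ∈ t, |(b 0).1| ≤ N := by
    obtain ⟨x, hx⟩ := (htf.image fun b : Loop k β => |(b 0).1|).bddAbove
    obtain ⟨N, hN⟩ := exists_nat_ge x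
    exact ⟨N, fun b hb => (hx (mem_image_of_mem _ hb)).trans hN⟩
  refine le_iSup_of_le N ?_
  rw [← htn]
  exact encard_le_encard fun b hb => ⟨⟨(ht hb).1, abs_le.1 (hN b hb)⟩, (ht hb).2⟩

theorem generateFrom_localEvents :
    instMeasurableSpaceConf = MeasurableSpace.generateFrom (localEvents k β) := by
  refine le_antisymm ?_ (MeasurableSpace.generateFrom_le ?_)
  · refine iSup₂_le fun A hA => ?_
    rw [← measurable_iff_comap_le]
    have h : count A = fun ω : Conf k β => ⨆ N : ℕ, count A (proj (slab k (Icc (-N : ℝ) N)) ω) :=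
      funext fun ω => count_eq_iSup A ω
    rw [h]
    have : BorelSpace ℕ∞ := by
      refine ⟨le_antisymm (fun s _ => ?_) (fun s _ => MeasurableSet.of_discrete)⟩
      let : MeasurableSpace ℕ∞ := borel _
      have : BorelSpace ℕ∞ := ⟨rfl⟩
      exact s.to_countable.measurableSet
    refine Measurable.iSup (mδ := MeasurableSpace.generateFrom (localEvents k β)) fun N => ?_
    intro s hs
    exact MeasurableSpace.measurableSet_generateFrom ⟨N, count A ⁻¹' s, measurable_count hA hs, rfl⟩
  · rintro _ ⟨N, A, hA, rfl⟩
    exact measurable_proj_window N hA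

/-- Local events form a π-system generating the σ-algebra, so invariance can be tested on local
observables. In this form it consists of equalities between continuous functions of `P`, hence is
closed. -/
theorem isStationary_iff {P : ProbabilityMeasure (Conf k β)} :
    IsStationary P ↔ ∀ (n : ℤ) (N : ℕ) (f : BddMeasurable (Conf k β)),
      ∫ ω, f.1 (proj (slab k (Icc (-N : ℝ) N)) (shift n ω)) ∂(P : Measure (Conf k β)) =
        ∫ ω, f.1 (proj (slab k (Icc (-N : ℝ) N)) ω) ∂(P : Measure (Conf k β)) := by
  constructor
  · intro hP n N f
    exact hP.integral_shift n (f.2.1.comp (measurable_proj_window N))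
  · intro h n
    have := Measure.isProbabilityMeasure_map (μ := (P : Measure (Conf k β)))
      (measurable_shift (k := k) (β := β) n).aemeasurable
    refine ext_of_generate_finite (localEvents k β) generateFrom_localEvents
      isPiSystem_localEvents ?_ (by simp)
    rintro _ ⟨N, A, hA, rfl⟩
    have h1 := h n N ⟨A.indicator fun _ => 1, measurable_const.indicator hA, 1, fun ω => by
      by_cases hω : ω ∈ A <;> simp [hω]⟩
    have hA' := measurable_proj_window N hA
    have h2 : ∀ ω : Conf k β, A.indicator (fun _ => (1 : ℝ)) (proj (slab k (Icc (-N : ℝ) N)) ω) =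
      (proj (slab k (Icc (-N : ℝ) N)) ⁻¹' A).indicator (fun _ => 1) ω := fun ω => rfl
    have h3 : ∀ ω : Conf k β,
      A.indicator (fun _ => (1 : ℝ)) (proj (slab k (Icc (-N : ℝ) N)) (shift n ω)) =
      (shift n ⁻¹' (proj (slab k (Icc (-N : ℝ) N)) ⁻¹' A)).indicator (fun _ => 1) ω :=
      fun ω => rfl
    simp only [h3] at h1
    simp only [h2] at h1
    rw [integral_indicator_const _ hA', integral_indicator_const _ (measurable_shift n hA'),
      smul_eq_mul, smul_eq_mul, mul_one, mul_one] at h1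
    rw [Measure.map_apply (measurable_shift n) hA']
    exact (measureReal_eq_measureReal_iff).1 h1

theorem isClosed_isStationary : IsClosed {P : ProbabilityMeasure (Conf k β) | IsStationary P} := by
  simp only [isStationary_iff, ofPred_forall]
  refine isClosed_iInter fun n => isClosed_iInter fun N => isClosed_iInter fun f => ?_
  obtain ⟨C, hC⟩ := f.2.2
  exact isClosed_eq
    (continuous_integral_of_isBoundedLocal (isBoundedLocal_comp_proj_shift f.2.1 hC _ _ n))
    (continuous_integral_of_isBoundedLocal (isBoundedLocal_comp_proj f.2.1 hC _ _))

/-! ### The specific energy -/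

/-- The lower integral is a supremum over measurable simple functions below the integrand. Each of
them is bounded by `M`, so its integral over the box law is continuous in `P`; the integrand itself
need not be measurable. -/
theorem lowerSemicontinuous_boxEnergy (η : ℝ) (M : ℝ≥0) (N : ℕ) :
    LowerSemicontinuous fun P : ProbabilityMeasure (Conf k β) => boxEnergy η P M N := by
  simp only [boxEnergy_eq, lintegral]
  refine lowerSemicontinuous_iSup fun g => lowerSemicontinuous_iSup fun hg =>
    Continuous.lowerSemicontinuous ?_
  have hgM : ∀ ω, g ω ≤ M := fun ω => (hg ω).trans (min_le_right _ _)
  have hm : Measurable fun ω => (g ω).toReal := g.measurable.ennreal_toReal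
  have hC : ∀ ω, |(g ω).toReal| ≤ M := fun ω => by
    rw [abs_of_nonneg ENNReal.toReal_nonneg]
    exact ENNReal.toReal_le_of_le_ofReal M.2 (by simpa using hgM ω)
  have h : ∀ P : ProbabilityMeasure (Conf k β),
      g.lintegral ((P : Measure (Conf k β)).map (proj (box k N))) =
        ENNReal.ofReal (∫ ω, (g ω).toReal ∂(P : Measure (Conf k β)).map (proj (box k N))) := by
    intro P
    have := isProbabilityMeasure_map_proj (P : Measure (Conf k β)) N
    rw [ofReal_integral_eq_lintegral_ofReal (integrable_of_abs_le hm hC)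
      (ae_of_all _ fun _ => ENNReal.toReal_nonneg), ← SimpleFunc.lintegral_eq_lintegral]
    exact lintegral_congr fun ω =>
      (ENNReal.ofReal_toReal ((hgM ω).trans_lt ENNReal.coe_lt_top).ne).symm
  simp only [h]
  exact ENNReal.continuous_ofReal.comp (continuous_integral_map_proj hm hC N)

theorem boxEnergy_mono (η : ℝ) (P : ProbabilityMeasure (Conf k β)) (N : ℕ) :
    Monotone fun M => boxEnergy η P M N := fun M M' h => by
  refine lintegral_mono fun ω => ?_
  dsimp only
  gcongr

theorem mul_ent_le_freeEnergy (η : ℝ) (P : ProbabilityMeasure (Conf k β)) :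
    ENNReal.ofReal β⁻¹ * ent P ≤ freeEnergy η P := by
  unfold freeEnergy
  split_ifs
  · exact le_add_self
  · exact le_top

variable [Fact (0 < β)]

/-- Laws of bounded specific entropy have uniformly few long bridges. -/
theorem exists_excess_layer_le (k : ℕ) (β : ℝ) [Fact (0 < β)] {c ε : ℝ} (hc : 0 ≤ c)
    (hε : 0 < ε) : ∃ N₀ : ℕ, ∀ N ≥ N₀, ∀ P : ProbabilityMeasure (Conf k β),
      IsStationary P → ent P ≤ ENNReal.ofReal c →
        ∫⁻ ω, excess (Ico 0 1) (layer N) ω ∂(P : Measure (Conf k β)) ≤ ENNReal.ofReal ε := by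
  obtain ⟨R, hR⟩ := exists_lintegral_excess_le k β hc hε
  obtain ⟨N₀, hN₀⟩ := eventually_atTop.1 (tendsto_layer.eventually_ge_atTop R)
  exact ⟨N₀, fun N hN P hP hent => hR _ (hN₀ N hN) P ((hP.boxEntropy_le_ent one_pos).trans hent)⟩

theorem exists_mul_excess_layer_le (k : ℕ) (β : ℝ) [Fact (0 < β)] {c ε : ℝ} (hc : 0 ≤ c)
    (hε : 0 < ε) (M : ℝ≥0) : ∃ N₀ : ℕ, ∀ N ≥ N₀, ∀ P : ProbabilityMeasure (Conf k β),
      IsStationary P → ent P ≤ ENNReal.ofReal c →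
        2 * M * ∫⁻ ω, excess (Ico 0 1) (layer N) ω ∂(P : Measure (Conf k β)) ≤
          ENNReal.ofReal ε := by
  obtain ⟨N₀, hN₀⟩ := exists_excess_layer_le k β hc (ε := ε / (2 * M + 1)) (by positivity)
  refine ⟨N₀, fun N hN P hP hent => ?_⟩
  calc _ ≤ 2 * M * ENNReal.ofReal (ε / (2 * M + 1)) := by
        gcongr
        exact hN₀ N hN P hP hent
    _ = ENNReal.ofReal (2 * M * (ε / (2 * M + 1))) := by
        rw [ENNReal.ofReal_mul (by positivity), ENNReal.ofReal_mul (by positivity)]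
        simp
    _ ≤ ENNReal.ofReal ε := by
        refine ENNReal.ofReal_le_ofReal ?_
        rw [mul_div_assoc', div_le_iff₀ (by positivity)]
        nlinarith

/-- Finite entropy makes the superadditivity error vanish as `N` grows, so the limsup does not
exceed the liminf. -/
theorem IsStationary.tendsto_boxEnergy {P : ProbabilityMeasure (Conf k β)} (hP : IsStationary P)
    (hent : ent P < ∞) (η : ℝ) (M : ℝ≥0) :
    Tendsto (boxEnergy η P M) atTop (𝓝 (truncEnergy η P M)) := by
  have h : Tendsto (boxEnergy η P M) atTop (𝓝 (liminf (boxEnergy η P M) atTop)) := by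
    refine tendsto_of_le_liminf_of_limsup_le le_rfl ?_
    refine ENNReal.le_of_forall_pos_le_add fun ε hε _ => ?_
    obtain ⟨N₀, hN₀⟩ := exists_mul_excess_layer_le k β (c := (ent P).toReal) (ε := ε)
      ENNReal.toReal_nonneg hε M
    refine limsup_le_of_le (by isBoundedDefault) ?_
    filter_upwards [eventually_ge_atTop N₀, eventually_gt_atTop 0] with N hN hN0
    refine (hP.boxEnergy_le_liminf η M hN0).trans ?_
    gcongr
    have := hN₀ N hN P hP (by rw [ENNReal.ofReal_toReal hent.ne])
    simpa using this
  rw [truncEnergy, h.limUnder_eq]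
  exact h

theorem IsStationary.boxEnergy_le_truncEnergy_add {P : ProbabilityMeasure (Conf k β)}
    (hP : IsStationary P) (hent : ent P < ∞) (η : ℝ) (M : ℝ≥0) {N : ℕ} (hN : 0 < N) :
    boxEnergy η P M N ≤ truncEnergy η P M +
      2 * M * ∫⁻ ω, excess (Ico 0 1) (layer N) ω ∂(P : Measure (Conf k β)) := by
  rw [← (hP.tendsto_boxEnergy hent η M).liminf_eq]
  exact hP.boxEnergy_le_liminf η M hN

theorem IsStationary.monotone_truncEnergy {P : ProbabilityMeasure (Conf k β)}
    (hP : IsStationary P) (hent : ent P < ∞) (η : ℝ) : Monotone (truncEnergy η P) :=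
  fun M M' h => le_of_tendsto_of_tendsto' (hP.tendsto_boxEnergy hent η M)
    (hP.tendsto_boxEnergy hent η M') fun N => boxEnergy_mono η P N h

theorem IsStationary.tendsto_truncEnergy {P : ProbabilityMeasure (Conf k β)}
    (hP : IsStationary P) (hent : ent P < ∞) (η : ℝ) :
    Tendsto (truncEnergy η P) atTop (𝓝 (energy η P)) := by
  have h := tendsto_atTop_iSup (hP.monotone_truncEnergy hent η)
  rw [energy, h.limUnder_eq]
  exact h

theorem IsStationary.truncEnergy_le_energy {P : ProbabilityMeasure (Conf k β)}
    (hP : IsStationary P) (hent : ent P < ∞) (η : ℝ) (M : ℝ≥0) :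
    truncEnergy η P M ≤ energy η P :=
  (hP.monotone_truncEnergy hent η).ge_of_tendsto (hP.tendsto_truncEnergy hent η) M

/-! ### Lower semicontinuity of the free energy -/

theorem mul_boxEntropy_le_freeEnergy (η : ℝ) (P : ProbabilityMeasure (Conf k β)) {N : ℕ}
    (hN : 0 < N) : ENNReal.ofReal β⁻¹ * boxEntropy P N ≤ freeEnergy η P := by
  by_cases hP : IsStationary P
  · refine le_trans ?_ (mul_ent_le_freeEnergy η P)
    gcongr
    exact hP.boxEntropy_le_ent hN
  · simp [freeEnergy, hP]

theorem lowerSemicontinuous_const_mul_boxEntropy {N : ℕ} (hN : 0 < N) (c : ℝ) :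
    LowerSemicontinuous fun P : ProbabilityMeasure (Conf k β) =>
      ENNReal.ofReal c * boxEntropy P N := by
  exact (ENNReal.continuous_const_mul ENNReal.ofReal_ne_top).comp_lowerSemicontinuous
    (lowerSemicontinuous_boxEntropy hN) fun _ _ h => by dsimp only; gcongr

/-- Non-stationary laws form an open set on which the value is infinite, and at infinite entropy a
single box entropy already exceeds `y`. Otherwise a finite truncation and one large box nearly
attain the value at `P₀`; this box functional is lower semicontinuous and, on an entropy sublevel
set, exceeds the free energy by at most `ε`. -/
theorem lowerSemicontinuous_freeEnergy (η : ℝ) :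
    LowerSemicontinuous (freeEnergy η : ProbabilityMeasure (Conf k β) → ℝ≥0∞) := by
  have hβ : (0 : ℝ) < β := Fact.out
  have hβ' : ENNReal.ofReal β⁻¹ ≠ 0 := by simpa using hβ
  intro P₀ y hy
  by_cases hst : IsStationary P₀
  swap
  · have hopen := isClosed_isStationary (k := k) (β := β).isOpen_compl.mem_nhds hst
    filter_upwards [hopen] with P hP
    have : ¬ IsStationary P := hP
    simp only [freeEnergy, this, false_and, if_false]
    exact hy.trans_le le_top
  have hy' : y ≠ ∞ := (hy.trans_le le_top).ne
  have hlimE : Tendsto (fun N => ENNReal.ofReal β⁻¹ * boxEntropy P₀ N) atTop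
      (𝓝 (ENNReal.ofReal β⁻¹ * ent P₀)) :=
    ENNReal.Tendsto.const_mul hst.tendsto_boxEntropy (Or.inr ENNReal.ofReal_ne_top)
  by_cases hfin : ent P₀ < ∞
  swap
  · have htop : ent P₀ = ∞ := not_lt_top_iff.1 hfin
    rw [htop, ENNReal.mul_top hβ'] at hlimE
    obtain ⟨N, hN, hN0⟩ := ((hlimE.eventually_const_lt (lt_top_iff_ne_top.2 hy')).and
      (eventually_gt_atTop 0)).exists
    filter_upwards [lowerSemicontinuous_const_mul_boxEntropy hN0 β⁻¹ P₀ y hN] with P hP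
    exact hP.trans_le (mul_boxEntropy_le_freeEnergy η P hN0)
  have hF : freeEnergy η P₀ = energy η P₀ + ENNReal.ofReal β⁻¹ * ent P₀ :=
    if_pos ⟨hst, hfin⟩
  rw [hF] at hy
  obtain ⟨M, hM⟩ := (((hst.tendsto_truncEnergy hfin η).add
    (tendsto_const_nhds (x := ENNReal.ofReal β⁻¹ * ent P₀))).eventually_const_lt hy).exists
  obtain ⟨y', hyy', hy'M⟩ := exists_between hM
  obtain ⟨ε, hε, hεy⟩ : ∃ ε : ℝ, 0 < ε ∧ y + ENNReal.ofReal ε ≤ y' := by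
    have hne : y' ≠ ∞ := (hy'M.trans_le le_top).ne
    refine ⟨(y' - y).toReal, ENNReal.toReal_pos (tsub_pos_of_lt hyy').ne'
      (ENNReal.sub_ne_top hne), ?_⟩
    rw [ENNReal.ofReal_toReal (ENNReal.sub_ne_top hne), add_tsub_cancel_of_le hyy'.le]
  -- With this threshold, `ent P > c` alone pushes the free energy above `y`, so uniform control of
  -- stray bridges is needed only for `ent P ≤ c`.
  set c : ℝ := β * (y.toReal + 1) with hc
  obtain ⟨N₀, hN₀⟩ := exists_mul_excess_layer_le k β (c := c) (by positivity) hε M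
  have hG : ∀ᶠ N in atTop,
      y' < boxEnergy η P₀ M N + ENNReal.ofReal β⁻¹ * boxEntropy P₀ N :=
    ((hst.tendsto_boxEnergy hfin η M).add hlimE).eventually_const_lt hy'M
  obtain ⟨N, hN, hNN₀, hN0⟩ := (hG.and ((eventually_ge_atTop N₀).and
    (eventually_gt_atTop 0))).exists
  have hlsc := (lowerSemicontinuous_boxEnergy (k := k) (β := β) η M N).add
    (lowerSemicontinuous_const_mul_boxEntropy hN0 β⁻¹)
  filter_upwards [hlsc P₀ y' hN] with P hP
  by_cases hcond : IsStationary P ∧ ent P < ∞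
  swap
  · rw [freeEnergy, if_neg hcond]
    exact lt_top_iff_ne_top.2 hy'
  obtain ⟨hPst, hPfin⟩ := hcond
  rcases lt_or_ge (ENNReal.ofReal c) (ent P) with hlarge | hsmall
  · refine lt_of_lt_of_le ?_ (mul_ent_le_freeEnergy η P)
    calc y < ENNReal.ofReal (y.toReal + 1) := by
          rw [ENNReal.lt_ofReal_iff_toReal_lt hy']
          linarith
      _ = ENNReal.ofReal β⁻¹ * ENNReal.ofReal c := by
          rw [← ENNReal.ofReal_mul (by positivity), hc, inv_mul_cancel_left₀ hβ.ne']
      _ ≤ _ := by gcongr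
  · have h1 : boxEnergy η P M N + ENNReal.ofReal β⁻¹ * boxEntropy P N ≤
        freeEnergy η P + ENNReal.ofReal ε := by
      rw [freeEnergy, if_pos ⟨hPst, hPfin⟩, add_right_comm]
      refine add_le_add ((hPst.boxEnergy_le_truncEnergy_add hPfin η M hN0).trans ?_) ?_
      · exact add_le_add (hPst.truncEnergy_le_energy hPfin η M) (hN₀ N hNN₀ P hPst hsmall)
      · gcongr
        exact hPst.boxEntropy_le_ent hN0
    have h2 : y + ENNReal.ofReal ε < freeEnergy η P + ENNReal.ofReal ε :=
      hεy.trans_lt (hP.trans_le h1)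
    exact lt_of_add_lt_add_right h2

end

end QuantumJellium

/-! ### Existence of the limits and lower semicontinuity -/

theorem proposition3p2 (k : ℕ) (β η : ℝ) (hβ : 0 < β) (hη : 0 < η) (hη' : η < 1 / 4) :
    (∀ P : ProbabilityMeasure (QuantumJellium.Conf k β), QuantumJellium.IsStationary P →
      Tendsto (QuantumJellium.boxEntropy P) atTop (𝓝 (QuantumJellium.ent P))) ∧
    (∀ P : ProbabilityMeasure (QuantumJellium.Conf k β), QuantumJellium.IsStationary P →
      QuantumJellium.ent P < ∞ →
        (∀ M : ℝ≥0, Tendsto (QuantumJellium.boxEnergy η P M) atTop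
          (𝓝 (QuantumJellium.truncEnergy η P M))) ∧
        Tendsto (QuantumJellium.truncEnergy η P) atTop (𝓝 (QuantumJellium.energy η P))) ∧
    LowerSemicontinuous
      (QuantumJellium.freeEnergy η : ProbabilityMeasure (QuantumJellium.Conf k β) → ℝ≥0∞) := by
  have : Fact (0 < β) := ⟨hβ⟩
  exact ⟨fun P hP => hP.tendsto_boxEntropy,
    fun P hP hent => ⟨fun M => hP.tendsto_boxEnergy hent η M, hP.tendsto_truncEnergy hent η⟩,
    QuantumJellium.lowerSemicontinuous_freeEnergy η⟩
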